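/- Let $F$ be a number field and, for $N\ge 0$, let $w_N$ be the $N\times N$ matrix with ones on the antidiagonal and zeros elsewhere, $J_N=\begin{pmatrix}0&w_N\\-w_N&0\end{pmatrix}$, and $\operatorname{Sp}_N(F)=\{g\in\operatorname{GL}_{2N}(F): {}^tgJ_Ng=J_N\}$. For $g\in \operatorname{GL}_m(F)$ put $g^*=w_m\,{}^tg^{-1}w_m$. Fix $n$, and let $G=\operatorname{Sp}_{2n}(F)$, $\delta=\operatorname{diag}(1,-1,1,\dots,-1)\in\operatorname{GL}_{2n}(F)$, $\epsilon=\operatorname{diag}(\delta,\delta^*)\in G$, and let $X$ be the $G$-conjugacy class of $\epsilon$. Let $T$ be the diagonal torus of $G$ and $W=N_G(T)/T$ its Weyl group, with the length function given by the upper triangular Borel subgroup; elements of $W$ are regarded as $T$-cosets in $N_G(T)$. For integers $n_1,\dots,n_k>0$ and $r\ge0$ with $n_1+\dots+n_k+r=2n$ let $$M_{(n_1,\dots,n_k;r)}=\{\operatorname{diag}(g_1,\dots,g_k,h,g_k^*,\dots,g_1^*): g_i\in\operatorname{GL}_{n_i}(F),\ h\in\operatorname{Sp}_r(F)\}\subset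 G .$$ These are the (standard) Levi subgroups of $G$. For a Levi subgroup $M$ let $W^M\subset W$ be its Weyl group. For Levi subgroups $M,M'$ let $W(M,M')$ be the set of $w\in W$ of minimal length in $wW^M$ such that $wMw^{-1}=M'$, and let $W(M)=\bigcup_{M'}W(M,M')$, the union over all Levi subgroups $M'$. For Levi subgroups $M\subset L$ let $w_M^L$ be the element of maximal length in $W(M)\cap W^L$. A pair $(M,L)$ of Levi subgroups is called standard relevant if $$M=M_{(r_1,r_1,\dots,r_k,r_k,s_1,\dots,s_l,t_1,\dots,t_m;u)},\qquad L=M_{(2r_1,\dots,2r_k,s_1,\dots,s_l;v)}$$ (with $k,l,m,u,v$ possibly zero), where $t_1,\dots,t_m$ are even and $v=u+t_1+\dots+t_m$. For a Levi subgroup $M$ of $G$ let $\mathcal W_M=\{w\in W(M,M): wM\cap X\neq\emptyset\}$. Then for every Levi subgroup $M$ of $G$ $$\mathcal W_M=\{\sigma w_{M'}^{L'}\sigma^{-1}: (M',L')\text{ is a standard relevant pair and }\sigma\in W(M',M)\}.$$ -/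

import Mathlib

noncomputable section

namespace SymplecticWeyl

/-- The matrix `J_N = [[0, w_N], [-w_N, 0]]`, where `w_N` has ones on the antidiagonal. -/
def J (F : Type*) [Field F] (N : ℕ) : Matrix (Fin (2 * N)) (Fin (2 * N)) F :=
  Matrix.of fun i j =>
    if (i : ℕ) + (j : ℕ) + 1 = 2 * N then (if (i : ℕ) < N then 1 else -1) else 0

/-- The symplectic group of rank `N` over `F`: all `g` in `GL_{2N}(F)` with `ᵗg J_N g = J_N`. -/
def Sp (F : Type*) [Field F] (N : ℕ) : Subgroup (GL (Fin (2 * N)) F) where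
  carrier := {g | (g : Matrix (Fin (2 * N)) (Fin (2 * N)) F).transpose * J F N * g.val = J F N}
  one_mem' := by simp
  mul_mem' := by
    intro a b ha hb
    simp only [Set.mem_setOf_eq, Units.val_mul, Matrix.transpose_mul] at *
    calc _ = b.val.transpose * (a.val.transpose * J F N * a.val) * b.val := by
          simp only [Matrix.mul_assoc]
      _ = _ := by rw [ha, hb]
  inv_mem' := by
    intro a ha
    simp only [Set.mem_setOf_eq] at *
    have h1 : a.val * (a⁻¹).val = 1 := by simp
    have h2 : (a⁻¹).val.transpose * a.val.transpose = 1 := by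
      rw [← Matrix.transpose_mul, h1, Matrix.transpose_one]
    calc _ = (a⁻¹).val.transpose * (a.val.transpose * J F N * a.val) * (a⁻¹).val := by rw [ha]
      _ = ((a⁻¹).val.transpose * a.val.transpose) * J F N * (a.val * (a⁻¹).val) := by
          simp only [Matrix.mul_assoc]
      _ = _ := by rw [h1, h2, Matrix.one_mul, Matrix.mul_one]

variable {F : Type*} [Field F] {N : ℕ}

/-- The `(i, j)` entry of an element of the symplectic group. -/
def entry (g : Sp F N) (i j : Fin (2 * N)) : F := g.val.val i j

/-- The subgroup of those `g` in the symplectic group that are block diagonal with respect to the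
partition of the index set into the fibres of `b`. -/
def blockDiagonal (F : Type*) [Field F] (N : ℕ) (b : Fin (2 * N) → ℕ) : Subgroup (Sp F N) where
  carrier := {g | ∀ i j, b i ≠ b j → entry g i j = 0}
  one_mem' := by
    intro i j h
    have : i ≠ j := fun h' => h (h' ▸ rfl)
    simp [entry, this]
  mul_mem' := by
    intro x y hx hy i j h
    simp only [entry, Subgroup.coe_mul, Units.val_mul, Matrix.mul_apply]
    refine Finset.sum_eq_zero fun k _ => ?_
    by_cases hk : b i = b k
    · rw [show y.val.val k j = 0 from hy k j (hk ▸ h), mul_zero]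
    · rw [show x.val.val i k = 0 from hx i k hk, zero_mul]
  inv_mem' := by
    intro x hx i j h
    have key : ∀ {β : Type} [LinearOrder β] (c : Fin (2 * N) → β),
        (∀ i j, c j < c i → entry x i j = 0) → ∀ i j, c j < c i → entry x⁻¹ i j = 0 := by
      intro β _ c hc i j hij
      have hb : Matrix.BlockTriangular x.val.val c := fun i j hij => hc i j hij
      haveI : Invertible x.val.val := x.val.isUnit.invertible
      have := Matrix.blockTriangular_inv_of_blockTriangular hb hij
      simpa [entry, Matrix.coe_units_inv] using this
    rcases lt_or_gt_of_ne h with h' | h'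
    · exact key (fun i => OrderDual.toDual (b i))
        (fun i j hij => hx i j (by
          have : b i < b j := hij
          exact this.ne)) i j h'
    · exact key b (fun i j hij => hx i j hij.ne') i j h'

/-- The index (from `0`) of the block containing position `i` (from `0`), for consecutive blocks
of the given sizes. -/
def blockIndex : List ℕ → ℕ → ℕ
  | [], _ => 0
  | a :: l, i => if i < a then 0 else blockIndex l (i - a) + 1

/-- For `n_1 + ⋯ + n_k + r = N`, the group `M_{(n_1, …, n_k; r)}` of block diagonal symplectic
matrices with block sizes `n_1, …, n_k, 2r, n_k, …, n_1`. These are the matrices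
`diag(g_1, …, g_k, h, g_k^*, …, g_1^*)` with `g_i` in `GL_{n_i}`, `h` in `Sp_r` and
`g^* = w ᵗg⁻¹ w`: the relation `ᵗg J g = J` determines the last `k` blocks from the first. -/
def levi (F : Type*) [Field F] (N : ℕ) (ns : List ℕ) (r : ℕ) : Subgroup (Sp F N) :=
  blockDiagonal F N fun i => blockIndex (ns ++ (2 * r) :: ns.reverse) i

/-- The standard Levi subgroups `M_{(n_1, …, n_k; r)}`, with `k, r ≥ 0`, `n_i > 0` and
`n_1 + ⋯ + n_k + r = N`. -/
def IsStandardLevi (M : Subgroup (Sp F N)) : Prop :=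
  ∃ (ns : List ℕ) (r : ℕ), (∀ a ∈ ns, 0 < a) ∧ ns.sum + r = N ∧ M = levi F N ns r

/-- The diagonal torus `T`. -/
def torus (F : Type*) [Field F] (N : ℕ) : Subgroup (Sp F N) :=
  blockDiagonal F N fun i => (i : ℕ)

/-- The normalizer `N_G(T)` of the diagonal torus. -/
abbrev torusNormalizer (F : Type*) [Field F] (N : ℕ) : Subgroup (Sp F N) :=
  Subgroup.normalizer (torus F N : Set (Sp F N))

/-- The Weyl group `W = N_G(T) / T`. -/
abbrev Weyl (F : Type*) [Field F] (N : ℕ) : Type _ :=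
  torusNormalizer F N ⧸ (torus F N).subgroupOf (torusNormalizer F N)

/-- The coset in `W` of an element of `N_G(T)`. -/
def toWeyl (g : torusNormalizer F N) : Weyl F N := QuotientGroup.mk g

/-- `t ↦ g⁻¹ t g` on `T`, for `g` in `N_G(T)`. -/
def conjTorus (g : torusNormalizer F N) (t : torus F N) : torus F N :=
  ⟨(g : Sp F N)⁻¹ * t * g, by
    have h := (Subgroup.mem_normalizer_iff.mp (inv_mem g.2) (t : Sp F N)).mp t.2
    simpa using h⟩

/-- The character `diag(a_1, …, a_{2N}) ↦ a_i / a_j` of `T`. Since `a_{2N+1-i} = a_i⁻¹` on `T`,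
these characters with `i ≠ j` are exactly the roots `±e_i ± e_j` (`1 ≤ i, j ≤ N`, nonzero). -/
def rootChar (i j : Fin (2 * N)) : torus F N → F := fun t => entry t.1 i i / entry t.1 j j

/-- The positive roots: those occurring in the upper triangular Borel subgroup. -/
def posRoots (F : Type*) [Field F] (N : ℕ) : Set (torus F N → F) :=
  {α | ∃ i j, i < j ∧ α = rootChar i j}

/-- The negative roots. -/
def negRoots (F : Type*) [Field F] (N : ℕ) : Set (torus F N → F) :=
  {α | ∃ i j, j < i ∧ α = rootChar i j}

/-- The length of `w` in `W` with respect to the upper triangular Borel subgroup: the number of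
positive roots `α` such that `wα` is negative, where `(wα)(t) = α(g⁻¹ t g)` for `g` in `w`. -/
def length (w : Weyl F N) : ℕ :=
  Set.ncard {α | α ∈ posRoots F N ∧
    ∃ g, toWeyl g = w ∧ (fun t => α (conjTorus g t)) ∈ negRoots F N}

/-- The Weyl group `W^M` of `M`, as the subgroup of all `w` in `W` that have a representative
in `M`. -/
def weylOf (M : Subgroup (Sp F N)) : Subgroup (Weyl F N) :=
  (M.subgroupOf (torusNormalizer F N)).map (QuotientGroup.mk' _)

/-- `W(M, M')`: the set of `w` in `W` of minimal length in `w W^M` such that `w M w⁻¹ = M'`. -/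
def weylHom (M M' : Subgroup (Sp F N)) : Set (Weyl F N) :=
  {w | (∀ v ∈ weylOf M, length w ≤ length (w * v)) ∧
    ∃ g, toWeyl g = w ∧ M.map (MulAut.conj (g : Sp F N)).toMonoidHom = M'}

/-- `W(M)`: the union of the sets `W(M, M')` over all standard Levi subgroups `M'`. -/
def weylFrom (M : Subgroup (Sp F N)) : Set (Weyl F N) :=
  {w | ∃ M', IsStandardLevi M' ∧ w ∈ weylHom M M'}

/-- `w` is `w_M^L`, the element of maximal length in `W(M) ∩ W^L`. -/
def IsLongestRelative (M L : Subgroup (Sp F N)) (w : Weyl F N) : Prop :=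
  (w ∈ weylFrom M ∧ w ∈ weylOf L) ∧
    ∀ w' ∈ weylFrom M, w' ∈ weylOf L → w' ≠ w → length w' < length w

/-- `(M, L)` is a standard relevant pair:
`M = M_{(r_1, r_1, …, r_k, r_k, s_1, …, s_l, t_1, …, t_m; u)}` and
`L = M_{(2r_1, …, 2r_k, s_1, …, s_l; v)}`, where all `t_i` are even and
`v = u + t_1 + ⋯ + t_m`. -/
def IsStandardRelevant (M L : Subgroup (Sp F N)) : Prop :=
  ∃ (r s t : List ℕ) (u v : ℕ),
    (∀ a ∈ r, 0 < a) ∧ (∀ a ∈ s, 0 < a) ∧ (∀ a ∈ t, 0 < a) ∧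
    (∀ a ∈ t, Even a) ∧ v = u + t.sum ∧ 2 * r.sum + s.sum + v = N ∧
    M = levi F N (r.flatMap (fun a => [a, a]) ++ s ++ t) u ∧
    L = levi F N (r.map (fun a => 2 * a) ++ s) v

/-- The diagonal entries of `ε_N = diag(δ_N, δ_N^*)`, where `δ_N = diag(1, -1, 1, …)` and
`δ_N^*` is `δ_N` with its entries in the reverse order. -/
def epsEntry (F : Type*) [Field F] (N : ℕ) (i : Fin (2 * N)) : F :=
  if (i : ℕ) < N then (-1) ^ (i : ℕ) else (-1) ^ (2 * N - 1 - (i : ℕ))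

lemma epsEntry_mul_self (i : Fin (2 * N)) : epsEntry F N i * epsEntry F N i = 1 := by
  unfold epsEntry
  split_ifs <;> simp [← mul_pow]

/-- `ε_N` as an element of `GL_{2N}(F)`. -/
def epsGL (F : Type*) [Field F] (N : ℕ) : GL (Fin (2 * N)) F where
  val := Matrix.diagonal (epsEntry F N)
  inv := Matrix.diagonal (epsEntry F N)
  val_inv := by simp [Matrix.diagonal_mul_diagonal, epsEntry_mul_self]
  inv_val := by simp [Matrix.diagonal_mul_diagonal, epsEntry_mul_self]

/-- `ε_N = diag(δ_N, δ_N^*)` as an element of the symplectic group. -/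
def eps (F : Type*) [Field F] (N : ℕ) : Sp F N :=
  ⟨epsGL F N, by
    change (Matrix.diagonal (epsEntry F N)).transpose * J F N * Matrix.diagonal (epsEntry F N)
      = J F N
    ext i j
    rw [Matrix.diagonal_transpose, Matrix.mul_diagonal, Matrix.diagonal_mul]
    by_cases h : (i : ℕ) + (j : ℕ) + 1 = 2 * N
    · have : epsEntry F N i = epsEntry F N j := by
        unfold epsEntry
        split_ifs
        · omega
        · congr 1; omega
        · congr 1; omega
        · omega
      rw [mul_right_comm, this, epsEntry_mul_self, one_mul]
    · simp [J, h]⟩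

/-- The conjugacy class `X` of `ε = ε_{2n}` in `G = Sp_{2n}(F)`. -/
def X (F : Type*) [Field F] (n : ℕ) : Set (Sp F (2 * n)) :=
  {x | IsConj (eps F (2 * n)) x}

/-- The set `𝒲_M` of all `w` in `W(M, M)` such that `wM` meets `X`. -/
def weylAdmissible {n : ℕ} (M : Subgroup (Sp F (2 * n))) : Set (Weyl F (2 * n)) :=
  {w | w ∈ weylHom M M ∧
    ∃ g : torusNormalizer F (2 * n), toWeyl g = w ∧ ∃ m ∈ M, (g : Sp F (2 * n)) * m ∈ X F n}

end SymplecticWeyl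

end

/-! The torus normalizer consists of monomial matrices, so `W` is the group of permutations of the
`2N` positions commuting with the reversal `i ↦ i.rev`, and length is the number of inversions
counted up to reversal (`weylPerm`, `length_eq`). A standard Levi is given by a partition of the
positions into consecutive blocks. Minimality in `w W^M` means that the permutation is increasing on
each block (`minimal_iff`), and `W(M, M')` consists of such permutations carrying blocks to blocks
(`mem_weylHom_iff`). They are determined by their effect on the blocks
(`perm_unique_of_increasing_on_fibres`).

The arithmetic is in `mem_weylAdmissible_iff`: for `w` in `W(M, M)` with permutation `π`, the coset
`wM` meets `X` exactly when `π` is an involution with `π i ≠ i.rev` for all `i`. If `x = g m` lies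
in `X`, then `x * x = 1`; hence `π * π` preserves the blocks, is increasing on them and is trivial.
If `π i = i.rev`, then `x` carries the block of `i` to its opposite, so `J x` restricts to an
invertible skew-symmetric matrix on that block and the block has even size. But reversal after `π`
is an order reversing involution of the block with fixed point `i`, which forces odd size.
Conversely, such a `π` is realised by a signed permutation matrix diagonalised by rescaled vectors
`e i ± e (π i)`; the signs can be balanced so that the diagonal form is conjugate to `eps`
(`exists_hasPerm_mem_X`).

What remains is combinatorics of the blocks. An involution of the blocks commuting with reversal has
exchanged pairs (sizes `r`), fixed blocks (`s`), blocks exchanged with their opposites (`t`) and a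
middle block. Listing representatives in this order, with exchanged partners adjacent, gives a
standard relevant pair `(M', L')`, and the reordering is `σ`. On the blocks of `M'` inside each
block of `L'` the transported involution reverses the order, so it has all the inversions possible
in `W(M') ∩ W^{L'}` and is the longest element (`blockIndex_of_reversing`, `isLongestRelative_iff`).
The condition `π i ≠ i.rev` becomes the evenness of `t`. -/

noncomputable section

namespace SymplecticWeyl

open Equiv

/-! ### Permutations that are increasing on the fibres of a function -/

/-- A permutation that preserves the fibres of `f` and is increasing on each of them is trivial. -/
lemma eq_one_of_increasing_on_fibres {m : ℕ} {Λ : Type*} (f : Fin m → Λ) (θ : Perm (Fin m))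
    (hf : ∀ i, f (θ i) = f i) (hθ : ∀ i j, i < j → f i = f j → θ i < θ j) : θ = 1 := by
  ext1 i
  induction i using WellFoundedLT.induction with
  | ind i ih =>
    simp only [Perm.coe_one, id_eq] at ih ⊢
    rcases lt_trichotomy (θ i) i with h | h | h
    · exact absurd (θ.injective (ih _ h)) h.ne
    · exact h
    -- The preimage of `i` cannot be smaller, since smaller points are fixed, nor larger, since then
    -- `θ` would reverse `i` and its preimage.
    · have hk : f (θ.symm i) = f i := by rw [← hf (θ.symm i), apply_symm_apply]
      rcases lt_trichotomy (θ.symm i) i with h' | h' | h'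
      · have := ih _ h'
        rw [apply_symm_apply] at this
        exact absurd this h'.ne'
      · rw [symm_apply_eq] at h'
        exact h'.symm
      · have := hθ i _ h' hk.symm
        rw [apply_symm_apply] at this
        exact absurd this h.asymm

/-- Permutations that are increasing on the fibres of `f` are determined by their effect on the
fibres. -/
lemma perm_unique_of_increasing_on_fibres {m : ℕ} {Λ : Type*} {f g : Fin m → Λ}
    {π π' : Perm (Fin m)} (h : ∀ i, g (π i) = f i) (h' : ∀ i, g (π' i) = f i)
    (hπ : ∀ i j, i < j → f i = f j → π i < π j)
    (hπ' : ∀ i j, i < j → f i = f j → π' i < π' j) : π' = π := by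
  have hf : ∀ i, f ((π⁻¹ * π') i) = f i := fun i => by
    rw [← h, Perm.mul_apply, ← h' i]
    exact congrArg g (π.apply_symm_apply _)
  have := eq_one_of_increasing_on_fibres f (π⁻¹ * π') hf fun i j hij hfij => by
    by_contra hlt
    rcases (not_lt.mp hlt).lt_or_eq with hlt | heq
    · have := hπ _ _ hlt (by rw [hf, hf, hfij])
      rw [← Perm.mul_apply, ← Perm.mul_apply, mul_inv_cancel_left] at this
      exact absurd this (hπ' i j hij hfij).asymm
    · exact hij.ne ((π⁻¹ * π').injective heq.symm)
  rw [inv_mul_eq_one] at this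
  exact this.symm

/-- Two functions whose fibres have the same sizes differ by a permutation that is increasing on
the fibres. -/
lemma exists_perm_increasing_on_fibres {m : ℕ} {Λ : Type*} [DecidableEq Λ] (f g : Fin m → Λ)
    (h : ∀ x, Fintype.card {i // f i = x} = Fintype.card {i // g i = x}) :
    ∃ π : Perm (Fin m), (∀ i, g (π i) = f i) ∧ ∀ i j, i < j → f i = f j → π i < π j := by
  let e : ∀ x, {i // f i = x} ≃o {i // g i = x} := fun x =>
    (Fintype.orderIsoFinOfCardEq {i // f i = x} rfl).symm.trans
      (Fintype.orderIsoFinOfCardEq {i // g i = x} (h x).symm)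
  let π : Perm (Fin m) := (sigmaFiberEquiv f).symm.trans
    ((Equiv.sigmaCongrRight fun x => (e x).toEquiv).trans (sigmaFiberEquiv g))
  have hπ : ∀ x (i : {i // f i = x}), π i = e x i := by
    rintro x ⟨i, rfl⟩
    rfl
  refine ⟨π, fun i => ?_, fun i j hij hf => ?_⟩
  · rw [hπ (f i) ⟨i, rfl⟩]
    exact (e (f i) ⟨i, rfl⟩).2
  · rw [hπ (f j) ⟨i, hf⟩, hπ (f j) ⟨j, rfl⟩]
    exact (e (f j)).strictMono hij

/-- The version of `exists_perm_increasing_on_fibres` for permutations commuting with the order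
reversal. -/
lemma exists_symm_perm_increasing_on_fibres {m : ℕ} {Λ : Type*} [DecidableEq Λ] (f g : Fin m → Λ)
    (n : Λ → Λ) (hn : ∀ x, n (n x) = x) (hf : ∀ i, f i.rev = n (f i)) (hg : ∀ i, g i.rev = n (g i))
    (h : ∀ x, Fintype.card {i // f i = x} = Fintype.card {i // g i = x}) :
    ∃ π : Perm (Fin m), (∀ i, π i.rev = (π i).rev) ∧ (∀ i, g (π i) = f i) ∧
      ∀ i j, i < j → f i = f j → π i < π j := by
  obtain ⟨π, hπ, hinc⟩ := exists_perm_increasing_on_fibres f g h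
  refine ⟨π, fun i => ?_, hπ, hinc⟩
  -- The conjugate of `π` by the reversal satisfies the same conditions, so uniqueness makes it
  -- equal to `π`.
  have := perm_unique_of_increasing_on_fibres (π' := Fin.revPerm * π * Fin.revPerm) hπ
    (fun i => by simp [hg, hπ, hf, hn]) hinc
    (fun i j hij hfij => by
      simpa using hinc _ _ (Fin.rev_lt_rev.mpr hij) (by rw [hf, hf, hfij]))
  have h2 := congrArg (fun π => π i.rev) this
  simpa using h2.symm

/-- An order reversing involution on a fibre has a fixed point only if the fibre has odd size. -/
lemma odd_card_fibre_of_fixed {m : ℕ} {Λ : Type*} [DecidableEq Λ] (f : Fin m → Λ)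
    (θ : Fin m → Fin m) (i : Fin m) (hθ : ∀ j, θ (θ j) = j) (hf : ∀ j, f j = f i → f (θ j) = f i)
    (hanti : ∀ j k, f j = f i → f k = f i → j < k → θ k < θ j) (hi : θ i = i) :
    Odd (Fintype.card {j // f j = f i}) := by
  -- `θ` exchanges the members of the fibre below `i` with those above it.
  have h1 : (Finset.univ.filter fun j => f j = f i ∧ j < i).card =
      (Finset.univ.filter fun j => f j = f i ∧ i < j).card := by
    refine Finset.card_bij' (fun j _ => θ j) (fun j _ => θ j) ?_ ?_ ?_ ?_
    · intro j hj
      simp only [Finset.mem_filter, Finset.mem_univ, true_and] at hj ⊢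
      exact ⟨hf j hj.1, by simpa [hi] using hanti j i hj.1 rfl hj.2⟩
    · intro j hj
      simp only [Finset.mem_filter, Finset.mem_univ, true_and] at hj ⊢
      exact ⟨hf j hj.1, by simpa [hi] using hanti i j rfl hj.1 hj.2⟩
    · exact fun j _ => hθ j
    · exact fun j _ => hθ j
  have h2 : (Finset.univ.filter fun j => f j = f i) =
      insert i ((Finset.univ.filter fun j => f j = f i ∧ j < i) ∪
        (Finset.univ.filter fun j => f j = f i ∧ i < j)) := by
    ext j
    simp only [Finset.mem_filter, Finset.mem_univ, true_and, Finset.mem_insert, Finset.mem_union]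
    rcases lt_trichotomy j i with h | h | h
    · simpa [h, h.ne] using fun h _ => h
    · simp [h]
    · simpa [h, h.ne'] using fun h _ => h
  rw [Fintype.card_subtype, h2, Finset.card_insert_of_notMem (by simp),
    Finset.card_union_of_disjoint, h1]
  · exact ⟨_, by ring⟩
  · rw [Finset.disjoint_filter]
    exact fun j _ h h' => h.2.asymm h'.2

/-- A finite set with an involution without fixed points has even size. -/
lemma even_card_of_fixedPointFree {α : Type*} [DecidableEq α] (s : Finset α) (θ : α → α)
    (hs : ∀ a ∈ s, θ a ∈ s) (hθ : ∀ a ∈ s, θ (θ a) = a) (hfree : ∀ a ∈ s, θ a ≠ a) :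
    Even s.card := by
  have : (s.card : ZMod 2) = 0 := by
    rw [Finset.cast_card]
    exact Finset.sum_involution (fun a _ => θ a) (fun _ _ => by decide)
      (fun a ha _ => hfree a ha) hs hθ
  rwa [ZMod.natCast_eq_zero_iff, ← even_iff_two_dvd] at this

/-! ### Inversions up to reversal and minimal coset representatives -/

/-- The inversions of a permutation. -/
def invPairs {m : ℕ} (π : Perm (Fin m)) : Set (Fin m × Fin m) :=
  {p | p.1 < p.2 ∧ π p.2 < π p.1}

/-- The involution `(i, j) ↦ (j', i')`, where `i'` is the reversal of `i`. -/
def pairRev {m : ℕ} (p : Fin m × Fin m) : Fin m × Fin m := (p.2.rev, p.1.rev)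

lemma pairRev_pairRev {m : ℕ} (p : Fin m × Fin m) : pairRev (pairRev p) = p := by
  simp [pairRev]

/-- The orbit of a pair under `pairRev`. -/
def pairClass {m : ℕ} (p : Fin m × Fin m) : Sym2 (Fin m × Fin m) := s(p, pairRev p)

lemma pairClass_eq_iff {m : ℕ} (p q : Fin m × Fin m) :
    pairClass p = pairClass q ↔ p = q ∨ p = pairRev q := by
  simp only [pairClass, Sym2.eq_iff]
  constructor
  · rintro (⟨h, -⟩ | ⟨h, -⟩)
    · exact Or.inl h
    · exact Or.inr h
  · rintro (h | h)
    · exact Or.inl ⟨h, by rw [h]⟩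
    · exact Or.inr ⟨h, by rw [h, pairRev_pairRev]⟩

/-- The number of inversions up to `pairRev`. -/
def permLength {m : ℕ} (π : Perm (Fin m)) : ℕ := (pairClass '' invPairs π).ncard

lemma pairRev_mem_invPairs {m : ℕ} {π : Perm (Fin m)} (hπ : ∀ i, π i.rev = (π i).rev)
    {p : Fin m × Fin m} (hp : p ∈ invPairs π) : pairRev p ∈ invPairs π := by
  simpa [invPairs, pairRev, hπ] using hp

/-- Closure of `A` under `pairRev` ensures that an orbit meeting `A` lies in `A`, so a pair outside
`A` contributes a new orbit. -/
lemma ncard_pairClass_lt {m : ℕ} {A B : Set (Fin m × Fin m)} (hA : ∀ p ∈ A, pairRev p ∈ A)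
    (h : A ⊂ B) : (pairClass '' A).ncard < (pairClass '' B).ncard := by
  refine Set.ncard_lt_ncard ⟨Set.image_mono h.1, fun hBA => h.2 fun p hp => ?_⟩ (Set.toFinite _)
  obtain ⟨q, hq, hqp⟩ := hBA (Set.mem_image_of_mem _ hp)
  rcases (pairClass_eq_iff q p).mp hqp with rfl | rfl
  · exact hq
  · simpa [pairRev_pairRev] using hA _ hq

/-- A block function: the blocks are consecutive, and the order reversal permutes them. -/
structure SymmBlocks {m : ℕ} (b : Fin m → ℕ) : Prop where
  mono : Monotone b
  rev : ∀ i j, b i = b j → b i.rev = b j.rev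

lemma permLength_lt_of_ssubset {m : ℕ} {π π' : Perm (Fin m)} (hπ : ∀ i, π i.rev = (π i).rev)
    (h : invPairs π ⊂ invPairs π') : permLength π < permLength π' :=
  ncard_pairClass_lt (fun _ => pairRev_mem_invPairs hπ) h

/-- The inversions decide the relative order of any two images, so `π' * π⁻¹` is increasing on all
positions. -/
lemma perm_eq_of_invPairs_eq {m : ℕ} {π π' : Perm (Fin m)} (h : invPairs π = invPairs π') :
    π = π' := by
  have key : ∀ (π π' : Perm (Fin m)), invPairs π = invPairs π' → ∀ i j, π i < π j → π' i < π' j := by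
    intro π π' h i j hij
    rcases lt_trichotomy i j with h' | h' | h'
    · have : (i, j) ∉ invPairs π' := by
        rw [← h]
        exact fun hp => hp.2.asymm hij
      have h2 : ¬ π' j < π' i := fun h3 => this ⟨h', h3⟩
      exact (not_lt.mp h2).lt_of_ne fun h3 => h'.ne (π'.injective h3)
    · exact absurd hij (by simp [h'])
    · have : (j, i) ∈ invPairs π' := by
        rw [← h]
        exact ⟨h', hij⟩
      exact this.2
  have := eq_one_of_increasing_on_fibres (fun _ => ()) (π' * π⁻¹) (fun _ => rfl)
    (fun i j hij _ => key π π' h _ _ (by simpa using hij))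
  rw [mul_inv_eq_one] at this
  exact this.symm

/-- Since `v` preserves the consecutive blocks, it keeps the order of positions in different blocks.
Thus `v × v` carries the inversions of `π * v` across blocks bijectively to those of `π`, and it
respects the orbits of `pairRev`. -/
lemma ncard_pairClass_outer_inversions {m : ℕ} {b : Fin m → ℕ} (hb : SymmBlocks b)
    (π v : Perm (Fin m)) (hv : ∀ i, v i.rev = (v i).rev) (hbv : ∀ i, b (v i) = b i) :
    (pairClass '' {p | p ∈ invPairs (π * v) ∧ b p.1 ≠ b p.2}).ncard =
      (pairClass '' {p | p ∈ invPairs π ∧ b p.1 ≠ b p.2}).ncard := by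
  have hlt : ∀ i j, i < j → b i ≠ b j → v i < v j := by
    intro i j hij hne
    by_contra h
    have := hb.mono (not_lt.mp h)
    rw [hbv, hbv] at this
    exact hne ((hb.mono hij.le).antisymm this)
  have hlt' : ∀ i j, v i < v j → b i ≠ b j → i < j := by
    intro i j hij hne
    by_contra h
    rcases (not_lt.mp h).lt_or_eq with h | h
    · exact (hlt j i h hne.symm).asymm hij
    · exact hne (by rw [h])
  have himg : {p | p ∈ invPairs π ∧ b p.1 ≠ b p.2} =
      Prod.map v v '' {p | p ∈ invPairs (π * v) ∧ b p.1 ≠ b p.2} := by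
    ext ⟨i, j⟩
    obtain ⟨i, rfl⟩ := v.surjective i
    obtain ⟨j, rfl⟩ := v.surjective j
    have : ∀ (A : Set (Fin m × Fin m)), (v i, v j) ∈ Prod.map v v '' A ↔ (i, j) ∈ A := fun A =>
      Function.Injective.mem_set_image (f := Prod.map v v) (v.injective.prodMap v.injective)
        (a := (i, j))
    rw [this]
    simp only [invPairs, Set.mem_ofPred_eq, hbv, Perm.mul_apply]
    exact ⟨fun h => ⟨⟨hlt' _ _ h.1.1 h.2, h.1.2⟩, h.2⟩, fun h => ⟨⟨hlt _ _ h.1.1 h.2, h.1.2⟩, h.2⟩⟩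
  have hcomp : ∀ p, pairClass (Prod.map v v p) = Sym2.map (Prod.map v v) (pairClass p) := by
    intro p
    simp [pairClass, pairRev, hv]
  rw [himg, Set.image_image]
  simp only [hcomp]
  rw [← Set.image_image (Sym2.map (Prod.map v v)) pairClass]
  exact (Set.ncard_image_of_injective _
    (Sym2.map.injective (v.injective.prodMap v.injective))).symm

/-- All inversions of `π` are across blocks, and their number is the same for every member of the
coset. -/
lemma permLength_le_of_increasing {m : ℕ} {b : Fin m → ℕ} (hb : SymmBlocks b)
    (π v : Perm (Fin m)) (hv : ∀ i, v i.rev = (v i).rev) (hbv : ∀ i, b (v i) = b i)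
    (hinc : ∀ i j, i < j → b i = b j → π i < π j) :
    permLength π ≤ permLength (π * v) := by
  have : invPairs π = {p | p ∈ invPairs π ∧ b p.1 ≠ b p.2} := by
    ext p
    exact ⟨fun hp => ⟨hp, fun h => (hinc _ _ hp.1 h).asymm hp.2⟩, fun hp => hp.1⟩
  rw [permLength, this, ← ncard_pairClass_outer_inversions hb π v hv hbv]
  exact Set.ncard_le_ncard (Set.image_mono fun p hp => hp.1) (Set.toFinite _)

/-- The coset of `π` has a member `ρ` that is increasing on the blocks. Its length counts the
inversions of `π` across blocks, so a single inversion of `π` inside a block would make `π` longer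
than `ρ`. -/
lemma increasing_of_permLength_le {m : ℕ} {b : Fin m → ℕ} (hb : SymmBlocks b) (π : Perm (Fin m))
    (hπ : ∀ i, π i.rev = (π i).rev)
    (hmin : ∀ v : Perm (Fin m), (∀ i, v i.rev = (v i).rev) → (∀ i, b (v i) = b i) →
      permLength π ≤ permLength (π * v)) : ∀ i j, i < j → b i = b j → π i < π j := by
  -- With the target function `b ∘ π.symm`, the permutation `π⁻¹ * ρ` preserves the blocks of `b`.
  obtain ⟨ρ, hρ, hinc⟩ := exists_perm_increasing_on_fibres b (b ∘ π.symm) fun x =>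
    Fintype.card_congr (π.subtypeEquiv fun a => by simp)
  simp only [Function.comp_apply] at hρ
  have hsymm : ∀ i, π.symm i.rev = (π.symm i).rev := fun i => by
    rw [symm_apply_eq, hπ, apply_symm_apply]
  have hrev : ∀ i, ρ i.rev = (ρ i).rev := by
    intro i
    have := perm_unique_of_increasing_on_fibres (g := b ∘ π.symm) (f := b)
      (π' := Fin.revPerm * ρ * Fin.revPerm) hρ
      (fun i => by
        have := hb.rev _ _ (hρ i.rev)
        simpa [hsymm] using this) hinc
      (fun i j hij hfij => by
        simpa using hinc _ _ (Fin.rev_lt_rev.mpr hij) (hb.rev _ _ hfij.symm))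
    have h2 := congrArg (fun π => π i.rev) this
    simpa using h2.symm
  have hv : ∀ i, (π⁻¹ * ρ) i.rev = ((π⁻¹ * ρ) i).rev := fun i => by
    simp only [Perm.mul_apply, hrev]
    exact hsymm _
  have hbv : ∀ i, b ((π⁻¹ * ρ) i) = b i := hρ
  have hle := hmin _ hv hbv
  have hout := ncard_pairClass_outer_inversions hb π _ hv hbv
  rw [mul_inv_cancel_left] at hle hout
  have hρout : {p | p ∈ invPairs ρ ∧ b p.1 ≠ b p.2} = invPairs ρ := by
    ext p
    exact ⟨fun hp => hp.1, fun hp => ⟨hp, fun h => (hinc _ _ hp.1 h).asymm hp.2⟩⟩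
  rw [hρout] at hout
  intro i j hij hbij
  by_contra hlt
  refine absurd hle (not_le.mpr ?_)
  have h3 : π j < π i := (not_lt.mp hlt).lt_of_ne fun h => hij.ne (π.injective h).symm
  rw [permLength, hout]
  refine ncard_pairClass_lt ?_ ⟨fun p hp => hp.1, fun h => (h (show (i, j) ∈ _ from ⟨hij, h3⟩)).2 hbij⟩
  rintro p ⟨hp, hne⟩
  refine ⟨pairRev_mem_invPairs hπ hp, fun h => hne ?_⟩
  have := hb.rev _ _ h
  simpa [pairRev] using this.symm

/-! ### Monomial matrices in the symplectic group -/

section symplectic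

variable {F : Type*} [Field F] {N : ℕ}

/-- The sign of the `i`-th row of `J`. -/
def sgn (F : Type*) [Field F] {N : ℕ} (i : Fin (2 * N)) : F := if (i : ℕ) < N then 1 else -1

lemma sgn_mul_self (i : Fin (2 * N)) : sgn F i * sgn F i = 1 := by
  unfold sgn
  split_ifs <;> simp

lemma sgn_ne_zero (i : Fin (2 * N)) : sgn F i ≠ 0 := fun h => by
  simpa [h] using sgn_mul_self (F := F) i

lemma sgn_rev (i : Fin (2 * N)) : sgn F i.rev = -sgn F i := by
  unfold sgn
  rw [Fin.val_rev]
  split_ifs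
  · omega
  · simp
  · simp
  · omega

lemma J_apply (i j : Fin (2 * N)) : J F N i j = if j = i.rev then sgn F i else 0 := by
  have : (i : ℕ) + (j : ℕ) + 1 = 2 * N ↔ j = i.rev := by
    rw [Fin.ext_iff, Fin.val_rev]
    omega
  simp [J, sgn, this]

lemma J_mul_apply (A : Matrix (Fin (2 * N)) (Fin (2 * N)) F) (i j : Fin (2 * N)) :
    (J F N * A) i j = sgn F i * A i.rev j := by
  simp [Matrix.mul_apply, J_apply]

lemma J_mul_J : J F N * J F N = -1 := by
  ext i j
  rw [J_mul_apply, J_apply, Fin.rev_rev, Matrix.neg_apply, Matrix.one_apply]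
  by_cases h : i = j
  · simp [h, sgn_rev, sgn_mul_self]
  · simp [h, Ne.symm h]

lemma transpose_mul_J_mul_apply (A : Matrix (Fin (2 * N)) (Fin (2 * N)) F) (i j : Fin (2 * N)) :
    (A.transpose * J F N * A) i j = ∑ a, A a i * sgn F a * A a.rev j := by
  rw [Matrix.mul_assoc, Matrix.mul_apply]
  simp [J_mul_apply, mul_assoc]

/-- The element of the symplectic group with a given matrix. -/
def ofMatrix (A : Matrix (Fin (2 * N)) (Fin (2 * N)) F) (h : A.transpose * J F N * A = J F N) :
    Sp F N :=
  have h' : -(J F N * A.transpose * J F N) * A = 1 := by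
    rw [Matrix.neg_mul, Matrix.mul_assoc, Matrix.mul_assoc, ← Matrix.mul_assoc A.transpose, h,
      J_mul_J, neg_neg]
  ⟨⟨A, -(J F N * A.transpose * J F N), mul_eq_one_comm.mp h', h'⟩, h⟩

lemma entry_mul (g h : Sp F N) (i j : Fin (2 * N)) :
    entry (g * h) i j = ∑ k, entry g i k * entry h k j := by
  simp [entry, Matrix.mul_apply]

lemma entry_one (i j : Fin (2 * N)) : entry (1 : Sp F N) i j = if i = j then 1 else 0 := by
  simp [entry, Matrix.one_apply]

lemma ext_entry {g h : Sp F N} (H : ∀ i j, entry g i j = entry h i j) : g = h :=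
  Subtype.ext (Units.ext (Matrix.ext H))

lemma sum_entry_rev (g : Sp F N) (i j : Fin (2 * N)) :
    ∑ a, entry g a i * sgn F a * entry g a.rev j = if j = i.rev then sgn F i else 0 := by
  have h : (g.val.val.transpose * J F N * g.val.val) i j = J F N i j :=
    congrFun (congrFun g.2 i) j
  rw [transpose_mul_J_mul_apply, J_apply] at h
  exact h

/-- The symplectic group element mapping the `j`-th basis vector to `ε j` times the `π j`-th. -/
def monomial (π : Perm (Fin (2 * N))) (ε : Fin (2 * N) → F) (hπ : ∀ i, π i.rev = (π i).rev)
    (hε : ∀ i, ε i * ε i.rev * sgn F (π i) = sgn F i) : Sp F N :=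
  ofMatrix (Matrix.of fun i j => if i = π j then ε j else 0) <| by
    ext i j
    rw [transpose_mul_J_mul_apply, J_apply, Finset.sum_eq_single (π i)]
    · by_cases h : j = i.rev
      · subst h
        simp only [Matrix.of_apply, hπ, if_true]
        rw [← hε i]
        ring
      · have : (π i).rev ≠ π j := by
          rw [← hπ]
          exact fun h' => h (π.injective h').symm
        simp [this, h]
    · intro a _ ha
      simp [ha]
    · simp

lemma entry_monomial {π : Perm (Fin (2 * N))} {ε : Fin (2 * N) → F}
    {hπ : ∀ i, π i.rev = (π i).rev} {hε : ∀ i, ε i * ε i.rev * sgn F (π i) = sgn F i}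
    (i j : Fin (2 * N)) : entry (monomial π ε hπ hε) i j = if i = π j then ε j else 0 := rfl

/-- The nonzero entries of `g` are those at `(π j, j)`. -/
def HasPerm (g : Sp F N) (π : Perm (Fin (2 * N))) : Prop := ∀ i j, entry g i j ≠ 0 ↔ i = π j

namespace HasPerm

variable {g h : Sp F N} {π ρ : Perm (Fin (2 * N))}

lemma ne_zero (hg : HasPerm g π) (i : Fin (2 * N)) : entry g (π i) i ≠ 0 := (hg _ _).mpr rfl

lemma eq_zero (hg : HasPerm g π) {i j : Fin (2 * N)} (h : i ≠ π j) : entry g i j = 0 := by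
  by_contra h'
  exact h ((hg _ _).mp h')

lemma unique (hg : HasPerm g π) (hg' : HasPerm g ρ) : π = ρ := by
  ext1 j
  exact (hg' _ _).mp (hg.ne_zero j)

lemma entry_mul_left (hg : HasPerm g π) (h : Sp F N) (i j : Fin (2 * N)) :
    entry (g * h) (π i) j = entry g (π i) i * entry h i j := by
  rw [entry_mul, Finset.sum_eq_single i]
  · intro k _ hk
    rw [hg.eq_zero (fun h => hk (π.injective h).symm), zero_mul]
  · simp

lemma entry_mul_right (hg : HasPerm g π) (h : Sp F N) (i j : Fin (2 * N)) :
    entry (h * g) i j = entry h i (π j) * entry g (π j) j := by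
  rw [entry_mul, Finset.sum_eq_single (π j)]
  · intro k _ hk
    rw [hg.eq_zero hk, mul_zero]
  · simp

lemma mul (hg : HasPerm g π) (hh : HasPerm h ρ) : HasPerm (g * h) (π * ρ) := by
  intro i j
  rw [hh.entry_mul_right, Perm.mul_apply, ← hg i (ρ j)]
  simp [hh.ne_zero j]

lemma inv (hg : HasPerm g π) : HasPerm g⁻¹ π⁻¹ := by
  intro i j
  have := hg.entry_mul_left g⁻¹ i j
  rw [mul_inv_cancel, entry_one] at this
  rw [Perm.eq_inv_iff_eq]
  by_cases h : π i = j
  · rw [if_pos h] at this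
    exact ⟨fun _ => h, fun _ h0 => by simp [h0] at this⟩
  · rw [if_neg h] at this
    have := (mul_eq_zero.mp this.symm).resolve_left (hg.ne_zero i)
    simp [this, h]

/-- The form pairs `e i` nontrivially with `e i.rev`, and `g` preserves it, so the single nonzero
entries of columns `i` and `i.rev` must lie in opposite rows. -/
lemma rev (hg : HasPerm g π) (i : Fin (2 * N)) : π i.rev = (π i).rev := by
  have h := sum_entry_rev g i i.rev
  rw [if_pos rfl, Finset.sum_eq_single (π i)] at h
  · have h' : entry g (π i).rev i.rev ≠ 0 := fun h0 => by
      rw [h0, mul_zero] at h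
      exact sgn_ne_zero i h.symm
    exact ((hg _ _).mp h').symm
  · intro a _ ha
    rw [hg.eq_zero ha, zero_mul, zero_mul]
  · simp

end HasPerm

lemma hasPerm_monomial {π : Perm (Fin (2 * N))} {ε : Fin (2 * N) → F}
    {hπ : ∀ i, π i.rev = (π i).rev} {hε : ∀ i, ε i * ε i.rev * sgn F (π i) = sgn F i} :
    HasPerm (monomial π ε hπ hε) π := by
  have hne : ∀ j, ε j ≠ 0 := fun j h => by
    have := hε j
    rw [h, zero_mul, zero_mul] at this
    exact sgn_ne_zero j this.symm
  intro i j
  rw [entry_monomial]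
  split_ifs with h <;> simp [h, hne]

lemma hasPerm_one_iff (t : Sp F N) : HasPerm t 1 ↔ t ∈ torus F N := by
  have hmem : t ∈ torus F N ↔ ∀ i j : Fin (2 * N), i ≠ j → entry t i j = 0 := by
    simp only [Ne, Fin.ext_iff]
    rfl
  rw [hmem]
  refine ⟨fun ht i j hij => ht.eq_zero hij, fun ht i j => ⟨fun h => ?_, ?_⟩⟩
  · by_contra hij
    exact h (ht i j hij)
  · rintro rfl h0
    change entry t i i = 0 at h0
    have : entry (t * t⁻¹) i i = 0 := by
      rw [entry_mul]
      refine Finset.sum_eq_zero fun k _ => ?_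
      by_cases hk : i = k
      · rw [← hk, h0, zero_mul]
      · rw [ht i k hk, zero_mul]
    simp [entry_one] at this

lemma HasPerm.mem_torusNormalizer {g : Sp F N} {π : Perm (Fin (2 * N))} (hg : HasPerm g π) :
    g ∈ torusNormalizer F N := by
  rw [Subgroup.mem_normalizer_iff]
  intro t
  rw [← hasPerm_one_iff, ← hasPerm_one_iff]
  constructor
  · intro ht
    simpa using (hg.mul ht).mul hg.inv
  · intro ht
    have := (hg.inv.mul ht).mul hg
    simpa [mul_assoc] using this

/-- Every order-reversal equivariant permutation occurs in the symplectic group. -/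
lemma exists_hasPerm (F : Type*) [Field F] (π : Perm (Fin (2 * N)))
    (hπ : ∀ i, π i.rev = (π i).rev) : ∃ g : Sp F N, HasPerm g π := by
  -- Only the product of the signs at `i` and `i.rev` is constrained, so the correction can be
  -- placed in the first half.
  refine ⟨monomial π (fun i => if (i : ℕ) < N then sgn F (π i) else 1) hπ fun i => ?_,
    hasPerm_monomial⟩
  simp only [Fin.val_rev, hπ, sgn_rev]
  by_cases h : (i : ℕ) < N
  · have h' : ¬ 2 * N - (i + 1) < N := by omega
    rw [if_pos h, if_neg h', mul_one, sgn_mul_self, sgn, if_pos h]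
  · have h' : 2 * N - (i + 1) < N := by omega
    rw [if_neg h, if_pos h', one_mul, neg_mul, sgn_mul_self, sgn, if_neg h]

lemma toWeyl_surjective (w : Weyl F N) : ∃ g : torusNormalizer F N, toWeyl g = w :=
  QuotientGroup.mk_surjective w

/-! ### The Weyl group as a permutation group, and its length function -/

section charZero

variable [CharZero F]

/-- In characteristic zero `2` has infinite order, so diagonal matrices of powers of `2` are
numerous enough to separate entries and characters of the torus. -/
lemma two_zpow_injective (F : Type*) [Field F] [CharZero F] {a b : ℤ}
    (h : (2 : F) ^ a = 2 ^ b) : a = b := by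
  have h' : (((2 : ℚ) ^ a : ℚ) : F) = ((2 : ℚ) ^ b : ℚ) := by
    push_cast
    exact h
  exact zpow_right_injective₀ (by norm_num) (by norm_num) (Rat.cast_injective h')

/-- The diagonal matrix with entries `2 ^ e i`. -/
def torusElt (F : Type*) [Field F] [CharZero F] (e : Fin (2 * N) → ℤ)
    (he : ∀ i, e i.rev = -e i) : torus F N :=
  ⟨monomial 1 (fun i => 2 ^ e i) (fun _ => rfl) (fun i => by
    rw [he, zpow_neg, mul_inv_cancel₀ (zpow_ne_zero _ two_ne_zero), one_mul, Perm.one_apply]),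
    (hasPerm_one_iff _).mp hasPerm_monomial⟩

lemma entry_torusElt (e : Fin (2 * N) → ℤ) (he : ∀ i, e i.rev = -e i) (i : Fin (2 * N)) :
    entry (torusElt F e he).1 i i = 2 ^ e i :=
  if_pos rfl

/-- If `t` is diagonal with distinct entries and `g * t * g⁻¹` is diagonal, comparing `g * t` with
`(g * t * g⁻¹) * g` allows one nonzero entry in each row of `g`. -/
lemma exists_hasPerm_of_mem_torusNormalizer {g : Sp F N} (hg : g ∈ torusNormalizer F N) :
    ∃ π, HasPerm g π := by
  -- The exponents are distinct and change sign under reversal, so they define a regular torus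
  -- element.
  let e : Fin (2 * N) → ℤ := fun i => 2 * (i : ℕ) + 1 - 2 * N
  have he : ∀ i, e i.rev = -e i := fun i => by
    simp only [e, Fin.val_rev]
    omega
  let t := torusElt F e he
  have ht := (hasPerm_one_iff _).mpr t.2
  have ht' := (hasPerm_one_iff _).mpr ((Subgroup.mem_normalizer_iff.mp hg t.1).mp t.2)
  have hrow : ∀ i j k, entry g i j ≠ 0 → entry g i k ≠ 0 → j = k := by
    have key : ∀ i j, entry g i j ≠ 0 → (2 : F) ^ e j = entry (g * t.1 * g⁻¹) i i := by
      intro i j hij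
      have h1 := ht.entry_mul_right g i j
      have h2 := ht'.entry_mul_left g i j
      rw [inv_mul_cancel_right] at h2
      simp only [Perm.one_apply] at h1 h2
      rw [h1, entry_torusElt] at h2
      exact mul_left_cancel₀ hij (h2.trans (mul_comm _ _))
    intro i j k hj hk
    have := two_zpow_injective F ((key i j hj).trans (key i k hk).symm)
    rw [Fin.ext_iff]
    simp only [e] at this
    omega
  have hcol : ∀ j, ∃ i, entry g i j ≠ 0 := by
    intro j
    by_contra! h
    have : entry (g⁻¹ * g) j j = 0 := by
      rw [entry_mul]
      exact Finset.sum_eq_zero fun k _ => by rw [h k, mul_zero]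
    simp [entry_one] at this
  choose φ hφ using hcol
  have hinj : Function.Injective φ := fun j k hjk => hrow (φ j) j k (hφ j) (hjk ▸ hφ k)
  refine ⟨Equiv.ofBijective φ (Finite.injective_iff_bijective.mp hinj), fun i j => ⟨fun h => ?_, ?_⟩⟩
  · obtain ⟨k, rfl⟩ := (Finite.injective_iff_surjective.mp hinj) i
    rw [hrow _ _ _ h (hφ k)]
    rfl
  · rintro rfl
    exact hφ j

/-- The permutation of an element of the normalizer of the torus. -/
def permOf (g : torusNormalizer F N) : Perm (Fin (2 * N)) :=
  (exists_hasPerm_of_mem_torusNormalizer g.2).choose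

lemma hasPerm_permOf (g : torusNormalizer F N) : HasPerm (g : Sp F N) (permOf g) :=
  (exists_hasPerm_of_mem_torusNormalizer g.2).choose_spec

/-- The permutation representation of the Weyl group. -/
def weylPerm : Weyl F N →* Perm (Fin (2 * N)) :=
  QuotientGroup.lift _
    (MonoidHom.mk' permOf fun g h =>
      (hasPerm_permOf (g * h)).unique ((hasPerm_permOf g).mul (hasPerm_permOf h)))
    fun g hg => (hasPerm_permOf g).unique ((hasPerm_one_iff _).mpr hg)

lemma hasPerm_iff (g : torusNormalizer F N) (π : Perm (Fin (2 * N))) :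
    HasPerm (g : Sp F N) π ↔ weylPerm (toWeyl g) = π := by
  have : weylPerm (toWeyl g) = permOf g := rfl
  rw [this]
  exact ⟨(hasPerm_permOf g).unique, fun h => h ▸ hasPerm_permOf g⟩

lemma hasPerm_weylPerm (g : torusNormalizer F N) : HasPerm (g : Sp F N) (weylPerm (toWeyl g)) :=
  (hasPerm_iff _ _).mpr rfl

lemma weylPerm_injective : Function.Injective (weylPerm (F := F) (N := N)) := by
  rw [injective_iff_map_eq_one]
  intro w hw
  obtain ⟨g, rfl⟩ := toWeyl_surjective w
  have := (hasPerm_iff g 1).mpr hw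
  exact (QuotientGroup.eq_one_iff g).mpr ((hasPerm_one_iff _).mp this)

lemma weylPerm_rev (w : Weyl F N) (i : Fin (2 * N)) :
    weylPerm w i.rev = (weylPerm w i).rev := by
  obtain ⟨g, rfl⟩ := toWeyl_surjective w
  exact (hasPerm_weylPerm g).rev i

lemma exists_weylPerm_eq (F : Type*) [Field F] [CharZero F] (π : Perm (Fin (2 * N)))
    (hπ : ∀ i, π i.rev = (π i).rev) : ∃ w : Weyl F N, weylPerm w = π := by
  obtain ⟨g, hg⟩ := exists_hasPerm F π hπ
  exact ⟨toWeyl ⟨g, hg.mem_torusNormalizer⟩, (hasPerm_iff _ _).mp hg⟩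

/-- The relation on the torus between opposite entries gives the only coincidences: `a i / a j`
equals `a j.rev / a i.rev`. -/
lemma rootChar_eq_iff (i j k l : Fin (2 * N)) (hij : i ≠ j) (hkl : k ≠ l) :
    (rootChar i j : torus F N → F) = rootChar k l ↔ pairClass (i, j) = pairClass (k, l) := by
  rw [pairClass_eq_iff]
  constructor
  · intro h
    -- The coordinate cocharacter at `p`, evaluated at `2`, reads off the coefficient of a root at
    -- `p`.
    let d : Fin (2 * N) → Fin (2 * N) → ℤ :=
      fun p i => (if i = p then 1 else 0) - (if i = p.rev then 1 else 0)
    have hd : ∀ p i, d p i.rev = -d p i := fun p i => by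
      simp only [d, Fin.rev_eq_iff, Fin.rev_rev]
      ring
    have key : ∀ p, d p i - d p j = d p k - d p l := by
      intro p
      have := congrFun h (torusElt F (d p) (hd p))
      simp only [rootChar, entry_torusElt] at this
      rw [← zpow_sub₀ two_ne_zero, ← zpow_sub₀ two_ne_zero] at this
      exact two_zpow_injective F this
    have hne : ∀ a : Fin (2 * N), a ≠ a.rev := fun a h => by
      have := congrArg Fin.val h
      rw [Fin.val_rev] at this
      omega
    have h1 : k = i ∨ l = i.rev := by
      by_contra! hcon
      have := key i
      simp only [d, if_neg hcon.1, if_neg hcon.2, if_neg hij.symm, if_neg (hne i), if_true] at this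
      split_ifs at this <;> omega
    rcases h1 with rfl | rfl
    · by_contra hcon
      have hlj : l ≠ j := fun h => hcon (Or.inl (by rw [h]))
      have := key j
      simp only [d, if_neg hlj, if_neg hij, if_neg (hne j), if_true] at this
      split_ifs at this <;> omega
    · by_contra hcon
      have hkj : k ≠ j.rev := fun h => hcon (Or.inr (by simp [pairRev, h]))
      have := key j.rev
      simp only [d, Fin.rev_rev, if_neg hkj, if_neg hij, if_neg (hne j), if_true,
        Fin.rev_eq_iff] at this
      split_ifs at this <;> omega
  · intro h
    have hrev : ∀ (t : torus F N) (a : Fin (2 * N)), entry t.1 a.rev a.rev = (entry t.1 a a)⁻¹ := by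
      intro t a
      have ht := (hasPerm_one_iff _).mpr t.2
      have := sum_entry_rev t.1 a a.rev
      rw [if_pos rfl, Finset.sum_eq_single a] at this
      · refine eq_inv_of_mul_eq_one_left ?_
        refine mul_right_cancel₀ (sgn_ne_zero (F := F) a) ?_
        linear_combination this
      · intro b _ hb
        rw [ht.eq_zero hb, zero_mul, zero_mul]
      · simp
    funext t
    simp only [pairRev, Prod.mk.injEq] at h
    rcases h with ⟨rfl, rfl⟩ | ⟨rfl, rfl⟩
    · rfl
    · simp only [rootChar, hrev]
      field_simp

lemma entry_conjTorus (g : torusNormalizer F N) (t : torus F N) (i : Fin (2 * N)) :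
    entry (conjTorus g t).1 i i =
      entry t.1 (weylPerm (toWeyl g) i) (weylPerm (toWeyl g) i) := by
  have hg := hasPerm_weylPerm g
  set π := weylPerm (toWeyl g)
  have h1 := hg.entry_mul_left (conjTorus g t).1 i i
  have h2 := ((hasPerm_one_iff _).mpr t.2).entry_mul_left g.1 (π i) i
  have h3 : g.1 * (conjTorus g t).1 = t.1 * g.1 := by simp [conjTorus, mul_assoc]
  rw [h3] at h1
  rw [Perm.one_apply] at h2
  rw [h2, mul_comm] at h1
  exact (mul_left_cancel₀ (hg.ne_zero i) h1).symm

/-- Off the diagonal, root characters coincide exactly along the orbits of `pairRev`, so each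
positive root made negative is one orbit of inversions. -/
lemma length_eq (w : Weyl F N) : length w = permLength (weylPerm w) := by
  have hset : {α | α ∈ posRoots F N ∧
      ∃ g, toWeyl g = w ∧ (fun t => α (conjTorus g t)) ∈ negRoots F N} =
      (fun p : Fin (2 * N) × Fin (2 * N) => (rootChar p.1 p.2 : torus F N → F)) ''
        invPairs (weylPerm w) := by
    have hcomp : ∀ (g : torusNormalizer F N) i j, (fun t => rootChar i j (conjTorus g t)) =
        rootChar (weylPerm (toWeyl g) i) (weylPerm (toWeyl g) j) := fun g i j => by
      funext t
      simp only [rootChar, entry_conjTorus]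
    ext α
    constructor
    · rintro ⟨⟨i, j, hij, rfl⟩, g, rfl, k, l, hkl, h⟩
      rw [hcomp, rootChar_eq_iff _ _ _ _ (by simpa using hij.ne) hkl.ne', pairClass_eq_iff] at h
      refine ⟨(i, j), ⟨hij, ?_⟩, rfl⟩
      simp only [pairRev, Prod.mk.injEq] at h
      rcases h with ⟨h1, h2⟩ | ⟨h1, h2⟩
      · simpa only [h1, h2] using hkl
      · simpa only [h1, h2, Fin.rev_lt_rev] using hkl
    · rintro ⟨⟨i, j⟩, ⟨hij, hlt⟩, rfl⟩
      obtain ⟨g, rfl⟩ := toWeyl_surjective w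
      exact ⟨⟨i, j, hij, rfl⟩, g, rfl, _, _, hlt, hcomp g i j⟩
  have himage : ∀ A : Set (Fin (2 * N) × Fin (2 * N)), (∀ p ∈ A, p.1 ≠ p.2) →
      ((fun p : Fin (2 * N) × Fin (2 * N) => (rootChar p.1 p.2 : torus F N → F)) '' A).ncard =
        (pairClass '' A).ncard := by
    intro A hA
    have heq : ∀ p ∈ A, ∀ q ∈ A, (rootChar p.1 p.2 : torus F N → F) = rootChar q.1 q.2 ↔
        pairClass p = pairClass q :=
      fun p hp q hq => rootChar_eq_iff _ _ _ _ (hA p hp) (hA q hq)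
    have hch : ∀ c : pairClass '' A, ∃ p ∈ A, pairClass p = c.1 := fun c => c.2
    choose s hs hsc using hch
    symm
    refine Set.ncard_congr (fun c hc => rootChar (s ⟨c, hc⟩).1 (s ⟨c, hc⟩).2) ?_ ?_ ?_
    · exact fun c hc => ⟨_, hs ⟨c, hc⟩, rfl⟩
    · intro c c' hc hc' h
      have := (heq _ (hs _) _ (hs _)).mp h
      rwa [hsc, hsc] at this
    · rintro _ ⟨p, hp, rfl⟩
      exact ⟨pairClass p, ⟨p, hp, rfl⟩, (heq _ (hs _) _ hp).mpr (hsc _)⟩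
  rw [length, hset, himage _ fun p hp => hp.1.ne, permLength]

end charZero

/-! ### Levi subgroups through their block functions -/

lemma HasPerm.mem_blockDiagonal_iff {g : Sp F N} {π : Perm (Fin (2 * N))} (hg : HasPerm g π)
    (b : Fin (2 * N) → ℕ) : g ∈ blockDiagonal F N b ↔ ∀ i, b (π i) = b i := by
  constructor
  · intro h i
    by_contra hne
    exact hg.ne_zero i (h _ _ hne)
  · intro h i j hij
    exact hg.eq_zero fun hi => hij (by rw [hi, h])

/-- Two positions in the same block are linked by an element of the block diagonal group. -/
lemma exists_mem_blockDiagonal_entry_ne_zero (F : Type*) [Field F] {b : Fin (2 * N) → ℕ}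
    (hb : SymmBlocks b) {i j : Fin (2 * N)} (hij : b i = b j) :
    ∃ g ∈ blockDiagonal F N b, entry g i j ≠ 0 := by
  obtain ⟨π, hπ, hbπ, hij⟩ : ∃ π : Perm (Fin (2 * N)), (∀ i, π i.rev = (π i).rev) ∧
      (∀ i, b (π i) = b i) ∧ π j = i := by
    have hswap : ∀ i j, b i = b j → ∀ k, b (swap i j k) = b k := by
      intro i j hij k
      rw [swap_apply_def]
      split_ifs with h h
      · rw [h, hij]
      · rw [h, hij]
      · rfl
    -- The transposition of `i` and `i.rev` commutes with the reversal by itself; for other pairs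
    -- the reversed transposition has to be added.
    by_cases h : j = i.rev
    · refine ⟨swap i j, fun k => ?_, hswap i j hij, swap_apply_right i j⟩
      subst h
      by_cases h1 : k = i
      · simp [h1]
      · by_cases h2 : k = i.rev
        · simp [h2]
        · rw [swap_apply_of_ne_of_ne h1 h2, swap_apply_of_ne_of_ne _ fun h => h1 (Fin.rev_inj.mp h)]
          exact fun h => h2 (by rw [← h, Fin.rev_rev])
    · have h' : i ≠ j.rev := fun h' => h (by rw [h', Fin.rev_rev])
      refine ⟨swap i j * swap i.rev j.rev, fun k => ?_, fun k => ?_, ?_⟩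
      · by_cases hij' : i = j
        · simp [hij']
        have hne : ∀ a : Fin (2 * N), a ≠ a.rev := fun a h => by
          have := congrArg Fin.val h
          rw [Fin.val_rev] at this
          omega
        have hne' : ∀ a : Fin (2 * N), a.rev ≠ a := fun a => (hne a).symm
        simp only [Perm.mul_apply, swap_apply_def, Fin.rev_eq_iff]
        split_ifs <;> simp_all [Fin.rev_eq_iff]
      · rw [Perm.mul_apply, hswap i j hij, hswap _ _ (hb.rev _ _ hij)]
      · rw [Perm.mul_apply, swap_apply_of_ne_of_ne h, swap_apply_right]
        exact fun h => by
          have := congrArg Fin.val h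
          rw [Fin.val_rev] at this
          omega
  obtain ⟨g, hg⟩ := exists_hasPerm F π hπ
  exact ⟨g, (hg.mem_blockDiagonal_iff b).mpr hbπ, (hg _ _).mpr hij.symm⟩

/-- Conjugation of block diagonal groups by monomial matrices. -/
lemma HasPerm.map_conj_eq_iff {g : Sp F N} {π : Perm (Fin (2 * N))} (hg : HasPerm g π)
    {b b' : Fin (2 * N) → ℕ} (hb : SymmBlocks b) (hb' : SymmBlocks b') :
    (blockDiagonal F N b).map (MulAut.conj g).toMonoidHom = blockDiagonal F N b' ↔
      ∀ i j, b i = b j ↔ b' (π i) = b' (π j) := by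
  have hconj : ∀ (m : Sp F N) i j, entry (g * m * g⁻¹) (π i) (π j) =
      entry g (π i) i * entry m i j * entry g⁻¹ j (π j) := by
    intro m i j
    have h := hg.inv.entry_mul_right (g * m) (π i) (π j)
    rw [← Perm.mul_apply, inv_mul_cancel, Perm.one_apply] at h
    rw [h, hg.entry_mul_left]
  have hinv : ∀ j, entry g⁻¹ j (π j) ≠ 0 := fun j => (hg.inv _ _).mpr (π.symm_apply_apply j).symm
  constructor
  · intro h i j
    constructor
    · intro hij
      obtain ⟨m, hm, hne⟩ := exists_mem_blockDiagonal_entry_ne_zero F hb hij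
      have hmem : g * m * g⁻¹ ∈ blockDiagonal F N b' := h ▸ ⟨m, hm, rfl⟩
      by_contra hcon
      have h0 : entry (g * m * g⁻¹) (π i) (π j) = 0 := hmem _ _ hcon
      rw [hconj] at h0
      exact mul_ne_zero (mul_ne_zero (hg.ne_zero i) hne) (hinv j) h0
    · intro hij
      obtain ⟨m', hm', hne⟩ := exists_mem_blockDiagonal_entry_ne_zero F hb' hij
      rw [← h] at hm'
      obtain ⟨m, hm, rfl⟩ := hm'
      by_contra hcon
      refine hne ?_
      change entry (g * m * g⁻¹) (π i) (π j) = 0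
      rw [hconj, show entry m i j = 0 from hm _ _ hcon, mul_zero, zero_mul]
  · intro h
    ext m'
    constructor
    · rintro ⟨m, hm, rfl⟩ i j hij
      obtain ⟨i, rfl⟩ := π.surjective i
      obtain ⟨j, rfl⟩ := π.surjective j
      change entry (g * m * g⁻¹) (π i) (π j) = 0
      rw [hconj, show entry m i j = 0 from hm _ _ fun h' => hij ((h i j).mp h'), mul_zero, zero_mul]
    · intro hm'
      refine ⟨g⁻¹ * m' * g, fun i j hij => ?_, by simp [mul_assoc]⟩
      have h0 : entry m' (π i) (π j) = 0 := hm' _ _ fun h' => hij ((h i j).mpr h')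
      have h1 := hconj (g⁻¹ * m' * g) i j
      rw [show g * (g⁻¹ * m' * g) * g⁻¹ = m' by group, h0] at h1
      have := (mul_eq_zero.mp h1.symm).resolve_right (hinv j)
      exact (mul_eq_zero.mp this).resolve_left (hg.ne_zero i)

section charZero

variable [CharZero F]

lemma mem_weylOf_iff (b : Fin (2 * N) → ℕ) (w : Weyl F N) :
    w ∈ weylOf (blockDiagonal F N b) ↔ ∀ i, b (weylPerm w i) = b i := by
  constructor
  · rintro ⟨g, hg, rfl⟩
    exact ((hasPerm_weylPerm g).mem_blockDiagonal_iff b).mp hg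
  · intro h
    obtain ⟨g, rfl⟩ := toWeyl_surjective w
    exact ⟨g, ((hasPerm_weylPerm g).mem_blockDiagonal_iff b).mpr h, rfl⟩

/-- Under `weylPerm` the coset `w W^M` becomes the products of a permutation with the block
preserving ones, where the inversion count decides minimality. -/
lemma minimal_iff {b : Fin (2 * N) → ℕ} (hb : SymmBlocks b) (w : Weyl F N) :
    (∀ v ∈ weylOf (blockDiagonal F N b), length w ≤ length (w * v)) ↔
      ∀ i j, i < j → b i = b j → weylPerm w i < weylPerm w j := by
  constructor
  · intro h
    refine increasing_of_permLength_le hb _ (weylPerm_rev w) fun v hv hbv => ?_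
    obtain ⟨v, rfl⟩ := exists_weylPerm_eq F v hv
    have := h v ((mem_weylOf_iff b v).mpr hbv)
    rwa [length_eq, length_eq, map_mul] at this
  · intro h v hv
    rw [length_eq, length_eq, map_mul]
    exact permLength_le_of_increasing hb _ _ (weylPerm_rev v) ((mem_weylOf_iff b v).mp hv) h

lemma mem_weylHom_iff {b b' : Fin (2 * N) → ℕ} (hb : SymmBlocks b) (hb' : SymmBlocks b')
    (w : Weyl F N) : w ∈ weylHom (blockDiagonal F N b) (blockDiagonal F N b') ↔
      (∀ i j, i < j → b i = b j → weylPerm w i < weylPerm w j) ∧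
        ∀ i j, b i = b j ↔ b' (weylPerm w i) = b' (weylPerm w j) := by
  refine and_congr (minimal_iff hb w) ⟨?_, fun h => ?_⟩
  · rintro ⟨g, rfl, h⟩
    exact ((hasPerm_weylPerm g).map_conj_eq_iff hb hb').mp h
  · obtain ⟨g, rfl⟩ := toWeyl_surjective w
    exact ⟨g, rfl, ((hasPerm_weylPerm g).map_conj_eq_iff hb hb').mpr h⟩

/-- An element with as many inversions as possible is the longest one. -/
lemma isLongestRelative_iff {b c : Fin (2 * N) → ℕ} (hb : SymmBlocks b) (hc : Monotone c)
    {w₀ : Weyl F N} (hw₀ : w₀ ∈ weylFrom (blockDiagonal F N b))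
    (hw₀' : w₀ ∈ weylOf (blockDiagonal F N c))
    (hinv : ∀ i j, i < j → c i = c j → b i ≠ b j → weylPerm w₀ j < weylPerm w₀ i) (w : Weyl F N) :
    IsLongestRelative (blockDiagonal F N b) (blockDiagonal F N c) w ↔ w = w₀ := by
  have hlt : ∀ w' ∈ weylFrom (blockDiagonal F N b), w' ∈ weylOf (blockDiagonal F N c) →
      w' ≠ w₀ → length w' < length w₀ := by
    rintro w' ⟨M', -, hw', -⟩ hw'c hne
    rw [minimal_iff hb] at hw'
    rw [mem_weylOf_iff] at hw'c
    rw [length_eq, length_eq]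
    refine permLength_lt_of_ssubset (weylPerm_rev w') (ssubset_of_subset_of_ne ?_ fun h =>
      hne (weylPerm_injective (perm_eq_of_invPairs_eq h)))
    -- An inversion of a competitor lies inside a block of `c`, which the competitor preserves, and
    -- joins different blocks of `b`, on which it is increasing; so it is also an inversion of `w₀`.
    rintro ⟨i, j⟩ ⟨hij, hlt⟩
    refine ⟨hij, hinv i j hij ?_ fun h => (hw' i j hij h).asymm hlt⟩
    refine (hc hij.le).antisymm ?_
    rw [← hw'c i, ← hw'c j]
    exact hc hlt.le
  constructor
  · intro h
    by_contra hne
    exact (hlt w h.1.1 h.1.2 hne).asymm (h.2 w₀ hw₀ hw₀' (Ne.symm hne))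
  · rintro rfl
    exact ⟨⟨hw₀, hw₀'⟩, hlt⟩

end charZero

/-! ### Constraints on cosets containing involutions -/

lemma ne_rev (i : Fin (2 * N)) : i ≠ i.rev := fun h => by
  have := congrArg Fin.val h
  rw [Fin.val_rev] at this
  omega

/-- A symplectic involution `x` makes `J x` skew-symmetric. -/
lemma involution_skew {x : Sp F N} (hx : x * x = 1) (j k : Fin (2 * N)) :
    sgn F k * entry x k.rev j = -(sgn F j * entry x j.rev k) := by
  have h1 : x.val.val.transpose * J F N * x.val.val = J F N := x.2
  have h2 : x.val.val * x.val.val = 1 := by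
    have := congrArg (fun y : Sp F N => y.val.val) hx
    simpa using this
  have h3 : x.val.val.transpose * J F N = J F N * x.val.val := by
    conv_rhs => rw [← h1]
    rw [Matrix.mul_assoc _ x.val.val x.val.val, h2, Matrix.mul_one]
  have h4 := congrFun (congrFun h3 j) k
  rw [J_mul_apply, Matrix.mul_apply, Finset.sum_eq_single k.rev] at h4
  · rw [J_apply, Fin.rev_rev, if_pos rfl, sgn_rev, Matrix.transpose_apply] at h4
    change entry x k.rev j * _ = _ * entry x j.rev k at h4
    linear_combination -h4
  · intro a _ ha
    rw [J_apply, if_neg, mul_zero]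
    exact fun h => ha (by rw [h, Fin.rev_rev])
  · simp

/-- A block that is mapped to its opposite by a symplectic involution has even size. -/
lemma not_odd_card_block [CharZero F] {b : Fin (2 * N) → ℕ} (hb : SymmBlocks b) {x : Sp F N}
    (hx : x * x = 1) (i : Fin (2 * N))
    (h : ∀ a j, b j = b i → entry x a j ≠ 0 → b a = b i.rev) :
    ¬ Odd (Fintype.card {j // b j = b i}) := by
  intro hodd
  -- `S` is the restriction of `J x` to the block. As `x` maps the block into its opposite and `x *
  -- x = 1`, `R` is its inverse. Being skew-symmetric of odd size, `S` would have determinant zero.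
  let S : Matrix {j // b j = b i} {j // b j = b i} F := Matrix.of fun l k =>
    sgn F l.1 * entry x l.1.rev k.1
  let R : Matrix {j // b j = b i} {j // b j = b i} F := Matrix.of fun j l =>
    entry x j.1 l.1.rev * sgn F l.1
  have hRS : R * S = 1 := by
    ext j k
    have h1 : entry (x * x) j.1 k.1 = if j = k then 1 else 0 := by
      rw [hx, entry_one]
      simp only [Subtype.ext_iff]
    rw [Matrix.one_apply, ← h1, entry_mul, ← Equiv.sum_comp Fin.revPerm,
      ← Fintype.sum_subtype_add_sum_subtype (fun l => b l = b i), Matrix.mul_apply,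
      Finset.sum_eq_zero (s := (Finset.univ : Finset {l // ¬ b l = b i})), add_zero]
    · refine Finset.sum_congr rfl fun l _ => ?_
      simp only [R, S, Matrix.of_apply, Fin.revPerm_apply]
      linear_combination entry x j.1 l.1.rev * entry x l.1.rev k.1 * sgn_mul_self (F := F) l.1
    · rintro ⟨l, hl⟩ _
      by_contra hne
      refine hl ?_
      have := hb.rev _ _ (h l.rev k.1 k.2 (right_ne_zero_of_mul hne))
      simpa using this
  have hS : S.transpose = -S := by
    ext j k
    exact involution_skew hx j.1 k.1
  have hdet : S.det ≠ 0 := fun h0 => by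
    have := congrArg Matrix.det hRS
    simp [h0] at this
  have := congrArg Matrix.det hS
  rw [Matrix.det_transpose, Matrix.det_neg, hodd.neg_one_pow] at this
  exact hdet (by linear_combination this / 2)

/-- The permutation of a coset meeting the involutions is an involution that maps no position to
the opposite position. -/
lemma involution_of_mem [CharZero F] {b : Fin (2 * N) → ℕ} (hb : SymmBlocks b)
    (g : torusNormalizer F N)
    (hinc : ∀ i j, i < j → b i = b j → weylPerm (toWeyl g) i < weylPerm (toWeyl g) j)
    (hblock : ∀ i j, b i = b j ↔ b (weylPerm (toWeyl g) i) = b (weylPerm (toWeyl g) j))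
    {m : Sp F N} (hm : m ∈ blockDiagonal F N b) (hx : g.1 * m * (g.1 * m) = 1) :
    (∀ i, weylPerm (toWeyl g) (weylPerm (toWeyl g) i) = i) ∧
      ∀ i, weylPerm (toWeyl g) i ≠ i.rev := by
  have hg := hasPerm_weylPerm g
  set π := weylPerm (toWeyl g)
  set x := g.1 * m with hxdef
  -- As `m` is block diagonal, `x` sends the block of `j` into the block of `π j`.
  have hentry : ∀ a j, entry x a j ≠ 0 → b (π j) = b a := by
    intro a j hne
    obtain ⟨i, rfl⟩ := π.surjective a
    rw [hxdef, hg.entry_mul_left] at hne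
    by_contra hcon
    refine right_ne_zero_of_mul hne (hm _ _ fun h => hcon ((hblock _ _).mp h.symm))
  have hsq : ∀ i, b (π (π i)) = b i := by
    intro i
    have h1 : entry (x * x) i i ≠ 0 := by simp [hx, entry_one]
    rw [entry_mul] at h1
    obtain ⟨a, -, ha⟩ := Finset.exists_ne_zero_of_sum_ne_zero h1
    rw [(hblock _ _).mp (hentry _ _ (right_ne_zero_of_mul ha)), hentry _ _ (left_ne_zero_of_mul ha)]
  have hone : π * π = 1 := eq_one_of_increasing_on_fibres b _ hsq fun i j hij hbij =>
    hinc _ _ (hinc _ _ hij hbij) ((hblock _ _).mp hbij)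
  have hπ : ∀ i, π (π i) = i := fun i => congrArg (fun ρ => ρ i) hone
  refine ⟨hπ, fun i hi => ?_⟩
  refine not_odd_card_block hb hx i (fun a j hj ha => ?_) ?_
  · rw [← hentry a j ha, ← hi]
    exact (hblock _ _).mp hj
  -- Reversal after `π` maps the block of `i` to itself, reverses its order and fixes `i`.
  · refine odd_card_fibre_of_fixed b (fun j => (π j).rev) i (fun j => ?_) (fun j hj => ?_)
      (fun j k hj hk hjk => ?_) ?_
    · simp [weylPerm_rev, π, hπ j]
    · have := hb.rev _ _ ((hblock _ _).mp hj)
      rw [this, hi, Fin.rev_rev]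
    · exact Fin.rev_lt_rev.mpr (hinc _ _ hjk (hj.trans hk.symm))
    · rw [hi, Fin.rev_rev]

/-! ### Realising involutive permutations inside the conjugacy class -/

section conjugator

variable {π : Perm (Fin (2 * N))}

/-- The symplectic matrix mapping the `i`-th basis vector `e i` to `p i • e i + q i • e (π i)`. -/
lemma exists_two_term_matrix (hπ : ∀ i, π i.rev = (π i).rev) (hsq : ∀ i, π (π i) = i)
    (p q : Fin (2 * N) → F)
    (hdiag : ∀ i, p i * p i.rev * sgn F i + q i * q i.rev * sgn F (π i) = sgn F i)
    (hfix : ∀ i, π i = i → q i = 0)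
    (hoff : ∀ i, p i * q (π i).rev * sgn F i + q i * p (π i).rev * sgn F (π i) = 0) :
    ∃ C : Sp F N, ∀ a i, entry C a i = (if a = i then p i else 0) + if a = π i then q i else 0 := by
  refine ⟨ofMatrix (Matrix.of fun a i => (if a = i then p i else 0) + if a = π i then q i else 0) ?_,
    fun _ _ => rfl⟩
  ext i j
  rw [transpose_mul_J_mul_apply, J_apply]
  simp only [Matrix.of_apply, add_mul, ite_mul, zero_mul, Finset.sum_add_distrib,
    Finset.sum_ite_eq', Finset.mem_univ, if_true]
  by_cases hj : j = i.rev
  · subst hj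
    have h3 : (π i).rev = π i.rev := (hπ i).symm
    by_cases hi : π i = i
    · have hi' : π i.rev = i.rev := by rw [hπ, hi]
      have := hdiag i
      rw [hfix i hi] at this
      simp only [hfix i hi, hfix _ hi']
      simp only [if_true, ite_self, add_zero, zero_mul] at this ⊢
      linear_combination this
    · have h1 : i.rev ≠ π i.rev := fun h => hi (by
        rw [hπ] at h
        exact (Fin.rev_inj.mp h).symm)
      rw [if_pos rfl, if_neg h1, h3, if_neg h1.symm, if_pos rfl, if_pos rfl]
      linear_combination hdiag i
  · have h2 : (π i).rev = π j ↔ j = i.rev := by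
      rw [← hπ, π.injective.eq_iff, eq_comm]
    rw [if_neg (Ne.symm hj), if_neg (fun h => hj (h2.mp h)), if_neg hj]
    by_cases hj' : j = (π i).rev
    · subst hj'
      have h4 : i.rev = π (π i).rev := by rw [hπ, hsq]
      rw [if_pos h4, if_pos rfl]
      linear_combination hoff i
    · have h4 : i.rev ≠ π j := fun h => hj' (by rw [← hπ, h, hsq])
      rw [if_neg h4, if_neg (Ne.symm hj')]
      ring

end conjugator

/-- The member of `{i, i.rev}` in the first half. -/
def lowRep (i : Fin (2 * N)) : Fin (2 * N) := if (i : ℕ) < N then i else i.rev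

lemma lowRep_lt (i : Fin (2 * N)) : (lowRep i : ℕ) < N := by
  unfold lowRep
  split_ifs with h
  · exact h
  · rw [Fin.val_rev]
    omega

lemma lowRep_of_lt {i : Fin (2 * N)} (h : (i : ℕ) < N) : lowRep i = i := if_pos h

lemma lowRep_rev (i : Fin (2 * N)) : lowRep i.rev = lowRep i := by
  unfold lowRep
  rw [Fin.val_rev, Fin.rev_rev]
  split_ifs <;> first | rfl | omega

lemma lowRep_eq_or (i : Fin (2 * N)) : lowRep i = i ∨ lowRep i = i.rev := by
  unfold lowRep
  split_ifs
  · exact Or.inl rfl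
  · exact Or.inr rfl

lemma lowRep_eq_iff (i j : Fin (2 * N)) : lowRep i = lowRep j ↔ i = j ∨ i = j.rev := by
  constructor
  · intro h
    rcases lowRep_eq_or i with h1 | h1 <;> rcases lowRep_eq_or j with h2 | h2
    · exact Or.inl (by rw [← h1, h, h2])
    · exact Or.inr (by rw [← h1, h, h2])
    · exact Or.inr (by rw [← h2, ← h, h1, Fin.rev_rev])
    · exact Or.inl (Fin.rev_inj.mp (by rw [← h1, h, h2]))
  · rintro (rfl | rfl)
    · rfl
    · exact lowRep_rev j

lemma card_low : (Finset.univ.filter fun i : Fin (2 * N) => (i : ℕ) < N).card = N := by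
  rw [Fin.card_filter_val_lt]
  omega

/-- A choice of signs, opposite on `i` and `π i`, with as many signs of each kind. -/
lemma exists_balanced_signs {n : ℕ} (π : Perm (Fin (2 * (2 * n))))
    (hπ : ∀ i, π i.rev = (π i).rev) (hsq : ∀ i, π (π i) = i) (hne : ∀ i, π i ≠ i.rev) :
    ∃ η : Fin (2 * (2 * n)) → Bool, (∀ i, η i.rev = η i) ∧ (∀ i, π i ≠ i → η (π i) = !η i) ∧
      (Finset.univ.filter fun i : Fin (2 * (2 * n)) => (i : ℕ) < 2 * n ∧ η i = true).card = n := by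
  have hlow : ∀ i, lowRep (π (lowRep (π i))) = lowRep i := by
    intro i
    rcases lowRep_eq_or (π i) with h | h
    · rw [h, hsq]
    · rw [h, hπ, hsq, lowRep_rev]
  let T := Finset.univ.filter fun i : Fin (2 * (2 * n)) =>
    (i : ℕ) < 2 * n ∧ lowRep i < lowRep (π i)
  let T' := Finset.univ.filter fun i : Fin (2 * (2 * n)) =>
    (i : ℕ) < 2 * n ∧ lowRep (π i) < lowRep i
  let P := Finset.univ.filter fun i : Fin (2 * (2 * n)) => (i : ℕ) < 2 * n ∧ π i = i
  have hTT' : T.card = T'.card := by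
    refine Finset.card_bij' (fun i _ => lowRep (π i)) (fun i _ => lowRep (π i)) ?_ ?_ ?_ ?_
    · intro i hi
      simp only [T, T', Finset.mem_filter, Finset.mem_univ, true_and] at hi ⊢
      refine ⟨lowRep_lt _, ?_⟩
      rw [hlow, lowRep_of_lt (lowRep_lt _)]
      exact hi.2
    · intro i hi
      simp only [T, T', Finset.mem_filter, Finset.mem_univ, true_and] at hi ⊢
      refine ⟨lowRep_lt _, ?_⟩
      rw [hlow, lowRep_of_lt (lowRep_lt _)]
      exact hi.2
    · intro i hi
      simp only [T, Finset.mem_filter, Finset.mem_univ, true_and] at hi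
      rw [hlow, lowRep_of_lt hi.1]
    · intro i hi
      simp only [T', Finset.mem_filter, Finset.mem_univ, true_and] at hi
      rw [hlow, lowRep_of_lt hi.1]
  have heq : ∀ i, lowRep (π i) = lowRep i ↔ π i = i := fun i => by
    rw [lowRep_eq_iff]
    exact or_iff_left (hne i)
  have hsum : T.card + T'.card + P.card = 2 * n := by
    have hd1 : Disjoint T T' := by
      rw [Finset.disjoint_filter]
      exact fun i _ h h' => h.2.asymm h'.2
    have hd2 : Disjoint (T ∪ T') P := by
      rw [Finset.disjoint_left]
      intro i hi hi'
      simp only [T, T', P, Finset.mem_union, Finset.mem_filter, Finset.mem_univ, true_and] at hi hi'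
      rw [hi'.2] at hi
      simp at hi
    rw [← Finset.card_union_of_disjoint hd1, ← Finset.card_union_of_disjoint hd2]
    refine Eq.trans (congrArg Finset.card ?_) (card_low (N := 2 * n))
    ext i
    simp only [T, T', P, Finset.mem_union, Finset.mem_filter, Finset.mem_univ, true_and,
      ← and_or_left, and_iff_left_iff_imp]
    intro _
    rcases lt_trichotomy (lowRep i) (lowRep (π i)) with h | h | h
    · exact Or.inl (Or.inl h)
    · exact Or.inr ((heq i).mp h.symm)
    · exact Or.inl (Or.inr h)
  -- Each moved pair of classes contributes one positive sign, `T.card` in total. The fixed classes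
  -- number `2 * n - 2 * T.card`, and half of them receive the remaining positive signs.
  obtain ⟨A, hAP, hA⟩ := Finset.exists_subset_card_eq (s := P) (n := n - T.card) (by omega)
  refine ⟨fun i => if π i = i then decide (lowRep i ∈ A) else decide (lowRep i < lowRep (π i)),
    fun i => ?_, fun i hi => ?_, ?_⟩
  · simp only [hπ, Fin.rev_inj, lowRep_rev]
  · have h1 : π (π i) ≠ π i := fun h => hi (π.injective h)
    beta_reduce
    rw [if_neg h1, if_neg hi, hsq]
    have := fun h => hi ((heq i).mp h)
    rcases lt_or_gt_of_ne this with h | h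
    · simp [h, h.asymm]
    · simp [h, h.asymm]
  · have hTA : (Finset.univ.filter fun i : Fin (2 * (2 * n)) => (i : ℕ) < 2 * n ∧
        (if π i = i then decide (lowRep i ∈ A) else decide (lowRep i < lowRep (π i))) = true) =
        T ∪ A := by
      ext i
      simp only [T, Finset.mem_union, Finset.mem_filter, Finset.mem_univ, true_and]
      have hAi : i ∈ A → (i : ℕ) < 2 * n ∧ π i = i := fun h => by
        simpa [P] using hAP h
      by_cases hi : π i = i
      · rw [if_pos hi, hi]
        by_cases hl : (i : ℕ) < 2 * n
        · simp [hl, lowRep_of_lt hl]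
        · simpa [hl] using fun h => hl (hAi h).1
      · rw [if_neg hi]
        simpa using fun h => absurd (hAi h).2 hi
    rw [hTA, Finset.card_union_of_disjoint, hA]
    · omega
    · rw [Finset.disjoint_left]
      intro i hi hi'
      have := hAP hi'
      simp only [T, P, Finset.mem_filter, Finset.mem_univ, true_and] at hi this
      rw [this.2] at hi
      exact lt_irrefl _ hi.2

/-- The sizes of the sets of positions in a given half with a given sign. -/
lemma card_half_sign {n : ℕ} (η : Fin (2 * (2 * n)) → Bool) (hη : ∀ i, η i.rev = η i)
    (hcard : (Finset.univ.filter fun i : Fin (2 * (2 * n)) =>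
      (i : ℕ) < 2 * n ∧ η i = true).card = n) (x : Bool × Bool) :
    Fintype.card {i : Fin (2 * (2 * n)) // (η i, decide ((i : ℕ) < 2 * n)) = x} = n := by
  have hlow : ∀ a, (Finset.univ.filter fun i : Fin (2 * (2 * n)) =>
      (i : ℕ) < 2 * n ∧ η i = a).card = n := by
    have hfalse : (Finset.univ.filter fun i : Fin (2 * (2 * n)) =>
        (i : ℕ) < 2 * n ∧ η i = false).card = n := by
      have := Finset.card_filter_add_card_filter_not
        (s := Finset.univ.filter fun i : Fin (2 * (2 * n)) => (i : ℕ) < 2 * n)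
        (fun i => η i = true)
      rw [Finset.filter_filter, Finset.filter_filter, hcard, card_low] at this
      simp only [Bool.not_eq_true] at this
      omega
    intro a
    cases a
    · exact hfalse
    · exact hcard
  obtain ⟨a, t⟩ := x
  rw [Fintype.card_subtype]
  refine Eq.trans ?_ (hlow a)
  cases t
  · refine Finset.card_bij' (fun i _ => i.rev) (fun i _ => i.rev) ?_ ?_ ?_ ?_
    · intro i hi
      simp only [Finset.mem_filter, Finset.mem_univ, true_and, Prod.mk.injEq, decide_eq_false_iff_not,
        hη, Fin.val_rev] at hi ⊢
      exact ⟨by omega, hi.1⟩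
    · intro i hi
      simp only [Finset.mem_filter, Finset.mem_univ, true_and, Prod.mk.injEq, decide_eq_false_iff_not,
        hη, Fin.val_rev] at hi ⊢
      exact ⟨hi.2, by omega⟩
    · exact fun i _ => Fin.rev_rev i
    · exact fun i _ => Fin.rev_rev i
  · congr 1
    ext i
    simp [and_comm]

/-- The scalar `±1` for a Boolean. -/
def boolSign (F : Type*) [Field F] (a : Bool) : F := if a then 1 else -1

lemma boolSign_mul_self (a : Bool) : boolSign F a * boolSign F a = 1 := by
  cases a <;> simp [boolSign]

lemma boolSign_not (a : Bool) : boolSign F (!a) = -boolSign F a := by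
  cases a <;> simp [boolSign]

/-- The diagonal symplectic involution with given signs. -/
def signDiag (F : Type*) [Field F] (η : Fin (2 * N) → Bool) (hη : ∀ i, η i.rev = η i) : Sp F N :=
  monomial 1 (fun i => boolSign F (η i)) (fun _ => rfl) fun i => by
    rw [hη, boolSign_mul_self, one_mul, Perm.one_apply]

lemma entry_signDiag {η : Fin (2 * N) → Bool} {hη : ∀ i, η i.rev = η i} (i j : Fin (2 * N)) :
    entry (signDiag F η hη) i j = if i = j then boolSign F (η j) else 0 := rfl

lemma entry_mul_signDiag (g : Sp F N) {η : Fin (2 * N) → Bool} {hη : ∀ i, η i.rev = η i}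
    (i j : Fin (2 * N)) : entry (g * signDiag F η hη) i j = entry g i j * boolSign F (η j) := by
  simp [entry_mul, entry_signDiag]

lemma entry_signDiag_mul (g : Sp F N) {η : Fin (2 * N) → Bool} {hη : ∀ i, η i.rev = η i}
    (i j : Fin (2 * N)) : entry (signDiag F η hη * g) i j = boolSign F (η i) * entry g i j := by
  simp [entry_mul, entry_signDiag]

/-- Each half has `n` positions of either sign, so a permutation commuting with reversal and
preserving the halves carries one sign pattern to the other. -/
lemma signDiag_isConj {n : ℕ} {η η' : Fin (2 * (2 * n)) → Bool} {hη : ∀ i, η i.rev = η i}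
    {hη' : ∀ i, η' i.rev = η' i}
    (h : (Finset.univ.filter fun i : Fin (2 * (2 * n)) => (i : ℕ) < 2 * n ∧ η i = true).card = n)
    (h' : (Finset.univ.filter fun i : Fin (2 * (2 * n)) => (i : ℕ) < 2 * n ∧ η' i = true).card = n) :
    IsConj (signDiag F η hη) (signDiag F η' hη') := by
  have hrev : ∀ i : Fin (2 * (2 * n)), decide ((i.rev : ℕ) < 2 * n) = !decide ((i : ℕ) < 2 * n) := by
    intro i
    rw [Fin.val_rev, ← decide_not, decide_eq_decide]
    omega
  obtain ⟨ρ, hρ, hηρ, -⟩ := exists_symm_perm_increasing_on_fibres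
    (fun i : Fin (2 * (2 * n)) => (η i, decide ((i : ℕ) < 2 * n)))
    (fun i : Fin (2 * (2 * n)) => (η' i, decide ((i : ℕ) < 2 * n)))
    (fun x => (x.1, !x.2)) (fun x => by simp) (fun i => by simp only [hη, hrev])
    (fun i => by simp only [hη', hrev])
    (fun x => by rw [card_half_sign η hη h, card_half_sign η' hη' h'])
  obtain ⟨g, hg⟩ := exists_hasPerm F ρ hρ
  rw [isConj_iff]
  refine ⟨g, ?_⟩
  rw [mul_inv_eq_iff_eq_mul]
  refine ext_entry fun i j => ?_
  rw [entry_mul_signDiag, entry_signDiag_mul]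
  by_cases hij : i = ρ j
  · have : η' (ρ j) = η j := congrArg Prod.fst (hηρ j)
    rw [hij, this, mul_comm]
  · rw [hg.eq_zero hij, zero_mul, mul_zero]

/-- The sign of `eps` at `i` is the parity of the representative of `{i, i.rev}` in the first half,
and half of the `2 * n` representatives are even. -/
lemma exists_eps_eq_signDiag (F : Type*) [Field F] (n : ℕ) :
    ∃ (η : Fin (2 * (2 * n)) → Bool) (hη : ∀ i, η i.rev = η i), eps F (2 * n) = signDiag F η hη ∧
      (Finset.univ.filter fun i : Fin (2 * (2 * n)) => (i : ℕ) < 2 * n ∧ η i = true).card = n := by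
  refine ⟨fun i => decide (Even (lowRep i : ℕ)), fun i => by simp only [lowRep_rev], ?_, ?_⟩
  · refine ext_entry fun i j => ?_
    rw [entry_signDiag]
    change Matrix.diagonal (epsEntry F (2 * n)) i j = _
    rw [Matrix.diagonal_apply]
    split_ifs with h
    · subst h
      have : epsEntry F (2 * n) i = (-1) ^ (lowRep i : ℕ) := by
        unfold epsEntry lowRep
        split_ifs
        · rfl
        · rw [Fin.val_rev]
          congr 1
          omega
      rw [this]
      rcases Nat.even_or_odd (lowRep i : ℕ) with h | h
      · simp [boolSign, h]
      · simp [boolSign, h]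
    · rfl
  · have : (Finset.univ.filter fun i : Fin (2 * (2 * n)) =>
        (i : ℕ) < 2 * n ∧ decide (Even (lowRep i : ℕ)) = true) =
        Finset.univ.image fun k : Fin n => (⟨2 * k, by omega⟩ : Fin (2 * (2 * n))) := by
      ext i
      simp only [Finset.mem_filter, Finset.mem_univ, true_and, decide_eq_true_eq, Finset.mem_image]
      constructor
      · rintro ⟨hi, he⟩
        rw [lowRep_of_lt hi] at he
        obtain ⟨k, hk⟩ := he
        exact ⟨⟨k, by omega⟩, Fin.ext (by simp only; omega)⟩
      · rintro ⟨k, rfl⟩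
        have hk : ((⟨2 * k, by omega⟩ : Fin (2 * (2 * n))) : ℕ) < 2 * n := by
          simp only
          omega
        refine ⟨hk, ?_⟩
        rw [lowRep_of_lt hk]
        exact even_two_mul _
    rw [this, Finset.card_image_of_injective, Finset.card_univ, Fintype.card_fin]
    intro k l hkl
    have := congrArg Fin.val hkl
    simp only at this
    exact Fin.ext (by omega)

/-- Signs making the permutation matrix of `π` symplectic, and constant on the orbits of `π`. -/
lemma exists_monomial_signs (F : Type*) [Field F] (π : Perm (Fin (2 * N)))
    (hπ : ∀ i, π i.rev = (π i).rev) (hsq : ∀ i, π (π i) = i) (hne : ∀ i, π i ≠ i.rev) :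
    ∃ ε : Fin (2 * N) → F, (∀ i, ε i * ε i = 1) ∧ (∀ i, ε (π i) = ε i) ∧
      ∀ i, ε i * ε i.rev * sgn F (π i) = sgn F i := by
  -- If `π` changes the half of `i`, then `ε i` and `ε i.rev` must be opposite. The orbits `{i, π
  -- i}` and `{i.rev, (π i).rev}` are disjoint because `π i ≠ i.rev`, and comparing their minima
  -- singles out one of them.
  let ε : Fin (2 * N) → F := fun i => if ((i : ℕ) < N ↔ (π i : ℕ) < N) then 1 else
    if min i (π i) < min i.rev (π i).rev then 1 else -1
  refine ⟨ε, fun i => ?_, fun i => ?_, fun i => ?_⟩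
  · simp only [ε]
    split_ifs <;> simp
  · simp only [ε, hsq, min_comm (π i), min_comm (π i).rev, Iff.comm (a := (π i : ℕ) < N)]
  · have hmin : min i.rev (π i).rev ≠ min i (π i) := by
      have h1 := hne i
      have h2 := ne_rev i
      have h3 := ne_rev (π i)
      have h4 : i ≠ (π i).rev := fun h => h1 (by rw [h, Fin.rev_rev, ← h])
      rcases min_choice i.rev (π i).rev with h | h <;> rcases min_choice i (π i) with h' | h' <;>
        rw [h, h']
      · exact h2.symm
      · exact h1.symm
      · exact h4.symm
      · exact h3.symm
    have hrev : ∀ j : Fin (2 * N), (j.rev : ℕ) < N ↔ ¬ (j : ℕ) < N := fun j => by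
      rw [Fin.val_rev]
      omega
    simp only [ε, hπ, Fin.rev_rev, hrev, not_iff_not]
    by_cases hside : ((i : ℕ) < N ↔ (π i : ℕ) < N)
    · rw [if_pos hside, one_mul, if_pos hside, one_mul]
      unfold sgn
      simp only [hside]
    · have hs : sgn F (π i) = -sgn F i := by
        unfold sgn
        by_cases h1 : (i : ℕ) < N
        · have h2 : ¬ (π i : ℕ) < N := fun h2 => hside ⟨fun _ => h2, fun _ => h1⟩
          rw [if_pos h1, if_neg h2]
        · have h2 : (π i : ℕ) < N := by
            by_contra h2
            exact hside ⟨fun h => absurd h h1, fun h => absurd h h2⟩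
          rw [if_neg h1, if_pos h2, neg_neg]
      rw [if_neg hside, if_neg hside, hs]
      rcases lt_or_gt_of_ne hmin with h | h
      · rw [if_neg h.asymm, if_pos h]
        ring
      · rw [if_pos h, if_neg h.asymm]
        ring

/-- An involution of the positions, commuting with the reversal but nowhere equal to it, is the
permutation of an element of `X`. -/
lemma exists_hasPerm_mem_X (F : Type*) [Field F] [CharZero F] {n : ℕ}
    (π : Perm (Fin (2 * (2 * n)))) (hπ : ∀ i, π i.rev = (π i).rev) (hsq : ∀ i, π (π i) = i)
    (hne : ∀ i, π i ≠ i.rev) : ∃ x ∈ X F n, HasPerm x π := by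
  obtain ⟨η, hη, hηπ, hcard⟩ := exists_balanced_signs π hπ hsq hne
  obtain ⟨ε, hε1, hεπ, hεs⟩ := exists_monomial_signs F π hπ hsq hne
  -- The vectors `e i ± e (π i)` pair to twice the standard value; scaling one half by `1 / 2`
  -- corrects this without a square root of `2`.
  let c : Fin (2 * (2 * n)) → F := fun i => if (i : ℕ) < 2 * n then 1 else 1 / 2
  have hc : ∀ i, c i * c i.rev = 1 / 2 := by
    intro i
    simp only [c, Fin.val_rev]
    split_ifs
    · omega
    · simp
    · simp
    · omega
  have hfixrev : ∀ i, π i.rev = i.rev ↔ π i = i := fun i => by rw [hπ, Fin.rev_inj]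
  have hfixπ : ∀ i, π (π i) = π i ↔ π i = i := fun i => π.injective.eq_iff
  let p : Fin (2 * (2 * n)) → F := fun i => if π i = i then 1 else c i
  -- For `π i ≠ i`, the vector `e i + η i * ε i • e (π i)` is an eigenvector of `x` with sign `η i`;
  -- it is paired with the one for `π i`, which has the opposite sign. These are the columns of `C`,
  -- up to `c`.
  let q : Fin (2 * (2 * n)) → F := fun i =>
    if π i = i then 0 else c i * (boolSign F (η i) * ε i)
  obtain ⟨C, hC⟩ := exists_two_term_matrix hπ hsq p q (fun i => by
      simp only [p, q, hfixrev, hη]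
      split_ifs with h
      · ring
      · linear_combination (sgn F i + (boolSign F (η i) * boolSign F (η i)) *
          (ε i * ε i.rev * sgn F (π i))) * hc i +
          1 / 2 * (ε i * ε i.rev * sgn F (π i)) * boolSign_mul_self (F := F) (η i) + 1 / 2 * hεs i)
    (fun i hi => if_pos hi) (fun i => by
      have h1 : π (π i).rev = (π i).rev ↔ π i = i := by rw [hfixrev, hfixπ]
      simp only [p, q, h1, hη]
      split_ifs with h
      · ring
      · have h2 : ε (π i).rev = ε i.rev := by rw [← hπ, hεπ]
        rw [hηπ i h, boolSign_not, h2]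
        have h3 : ε i * sgn F (π i) = ε i.rev * sgn F i := by
          linear_combination -(ε i * sgn F (π i)) * hε1 i.rev + ε i.rev * hεs i
        linear_combination c i * c (π i).rev * boolSign F (η i) * h3)
  -- At a fixed position the basis vector is itself the eigenvector, so its sign must be the
  -- prescribed one.
  let ε' : Fin (2 * (2 * n)) → F := fun i => if π i = i then boolSign F (η i) else ε i
  let x : Sp F (2 * n) := monomial π ε' hπ fun i => by
    simp only [ε', hfixrev, hη]
    split_ifs with h
    · rw [boolSign_mul_self, h, one_mul]
    · exact hεs i
  have hx : HasPerm x π := hasPerm_monomial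
  refine ⟨x, ?_, hx⟩
  obtain ⟨η₀, hη₀, heps, hcard₀⟩ := exists_eps_eq_signDiag F n
  change IsConj (eps F (2 * n)) x
  rw [heps]
  refine (signDiag_isConj (hη' := hη) hcard₀ hcard).trans ?_
  rw [isConj_iff]
  refine ⟨C, ?_⟩
  rw [mul_inv_eq_iff_eq_mul]
  refine ext_entry fun a j => ?_
  obtain ⟨a, rfl⟩ := π.surjective a
  have hxa : entry x (π a) a = ε' a := if_pos rfl
  rw [entry_mul_signDiag, hx.entry_mul_left, hC, hC, hxa]
  by_cases hj : π j = j
  · simp only [q, p, if_pos hj, ite_self, add_zero]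
    by_cases ha : a = j
    · subst ha
      simp [hj, ε']
    · have : π a ≠ j := fun h => ha (π.injective (by rw [h, hj]))
      simp [ha, this]
  · simp only [p, q, if_neg hj]
    by_cases ha : a = j
    · subst ha
      have h1 : a ≠ π a := Ne.symm hj
      simp only [if_neg hj, if_pos, if_neg h1, ε']
      linear_combination c a * ε a * boolSign_mul_self (F := F) (η a)
    · have h1 : π a ≠ π j := fun h => ha (π.injective h)
      by_cases ha' : π a = j
      · have h2 : a = π j := by rw [← ha', hsq]
        have h3 : π a ≠ a := by
          rw [ha']
          exact Ne.symm ha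
        simp only [if_pos ha', if_neg h1, if_neg ha, if_pos h2, ε', if_neg h3]
        rw [h2, hεπ]
        linear_combination -(c j * boolSign F (η j)) * hε1 j
      · have h2 : a ≠ π j := fun h => ha' (by rw [h, hsq])
        simp [ha', h1, ha, h2]

/-- The description of the admissible elements by permutations. -/
lemma mem_weylAdmissible_iff [CharZero F] {n : ℕ} {b : Fin (2 * (2 * n)) → ℕ} (hb : SymmBlocks b)
    (w : Weyl F (2 * n)) : w ∈ weylAdmissible (blockDiagonal F (2 * n) b) ↔
      w ∈ weylHom (blockDiagonal F (2 * n) b) (blockDiagonal F (2 * n) b) ∧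
        (∀ i, weylPerm w (weylPerm w i) = i) ∧ ∀ i, weylPerm w i ≠ i.rev := by
  refine and_congr_right fun hw => ?_
  rw [mem_weylHom_iff hb hb] at hw
  constructor
  · rintro ⟨g, rfl, m, hm, hX⟩
    refine involution_of_mem hb g hw.1 hw.2 hm ?_
    obtain ⟨η, hη, heps, -⟩ := exists_eps_eq_signDiag F n
    have hX' : IsConj (eps F (2 * n)) (g.1 * m) := hX
    rw [isConj_iff, heps] at hX'
    obtain ⟨c, hc⟩ := hX'
    have hsq : signDiag F η hη * signDiag F η hη = 1 := by
      refine ext_entry fun i j => ?_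
      rw [entry_mul_signDiag, entry_signDiag, entry_one]
      split_ifs
      · exact boolSign_mul_self _
      · exact zero_mul _
    rw [← hc, conj_mul, hsq, mul_one, mul_inv_cancel]
  · rintro ⟨hsq, hne⟩
    obtain ⟨x, hxX, hx⟩ := exists_hasPerm_mem_X F _ (weylPerm_rev w) hsq hne
    refine ⟨⟨x, hx.mem_torusNormalizer⟩, weylPerm_injective ((hasPerm_iff _ _).mp hx), 1,
      one_mem _, ?_⟩
    rw [mul_one]
    exact hxX

end symplectic

/-! ### Block indices of consecutive blocks -/

lemma blockIndex_mono (l : List ℕ) : Monotone (blockIndex l) := by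
  induction l with
  | nil => exact fun _ _ _ => le_rfl
  | cons a l ih =>
    intro i j hij
    simp only [blockIndex]
    split_ifs
    · exact le_rfl
    · omega
    · omega
    · exact Nat.succ_le_succ (ih (by omega))

lemma blockIndex_lt {l : List ℕ} {i : ℕ} (h : i < l.sum) : blockIndex l i < l.length := by
  induction l generalizing i with
  | nil => simp at h
  | cons a l ih =>
    rw [List.sum_cons] at h
    simp only [blockIndex, List.length_cons]
    split_ifs
    · omega
    · exact Nat.succ_lt_succ (ih (by omega))

lemma blockIndex_append (l l' : List ℕ) (i : ℕ) : blockIndex (l ++ l') i =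
    if i < l.sum then blockIndex l i else l.length + blockIndex l' (i - l.sum) := by
  induction l generalizing i with
  | nil => simp
  | cons a l ih =>
    simp only [List.cons_append, blockIndex, ih, List.sum_cons, List.length_cons, Nat.sub_sub]
    split_ifs <;> omega

/-- Reversing both the list and the position complements the block index. Empty blocks are allowed,
as the middle block may have size zero. -/
lemma blockIndex_reverse {l : List ℕ} {i : ℕ} (h : i < l.sum) :
    blockIndex l.reverse (l.sum - (i + 1)) + blockIndex l i + 1 = l.length := by
  induction l generalizing i with
  | nil => simp at h
  | cons a l ih =>
    rw [List.sum_cons] at h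
    rw [List.reverse_cons, blockIndex_append, List.sum_reverse, List.length_reverse, List.sum_cons]
    simp only [blockIndex, List.length_cons]
    by_cases hi : i < a
    · have h1 : ¬ a + l.sum - (i + 1) < l.sum := by omega
      have h2 : a + l.sum - (i + 1) - l.sum < a := by omega
      simp [hi, h1, h2]
    · have h1 : a + l.sum - (i + 1) < l.sum := by omega
      have h2 := ih (i := i - a) (by omega)
      rw [show l.sum - (i - a + 1) = a + l.sum - (i + 1) by omega] at h2
      rw [if_pos h1, if_neg hi]
      omega

lemma symmBlocks_blockIndex {N : ℕ} {l : List ℕ} (hl : l.reverse = l) (hsum : l.sum = 2 * N) :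
    SymmBlocks fun i : Fin (2 * N) => blockIndex l i := by
  refine ⟨fun i j hij => blockIndex_mono l hij, fun i j hij => ?_⟩
  have hi := blockIndex_reverse (l := l) (i := i) (by omega)
  have hj := blockIndex_reverse (l := l) (i := j) (by omega)
  simp only [Fin.val_rev]
  rw [hl, hsum] at hi hj
  omega

lemma symmBlocks_levi {N : ℕ} {ns : List ℕ} {r : ℕ} (h : ns.sum + r = N) :
    SymmBlocks fun i : Fin (2 * N) => blockIndex (ns ++ (2 * r) :: ns.reverse) i :=
  symmBlocks_blockIndex (by simp) (by
    simp only [List.sum_append, List.sum_cons, List.sum_reverse]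
    omega)

/-! ### Labelled blocks and groups of blocks -/

section labels

variable {Λ : Type*} (sz : Λ → ℕ) (d : Λ)

/-- The label of the block containing a position, for consecutive blocks labelled by a list. -/
def labelAt (l : List Λ) (i : ℕ) : Λ := l.getD (blockIndex (l.map sz) i) d

lemma labelAt_cons (a : Λ) (l : List Λ) (i : ℕ) :
    labelAt sz d (a :: l) i = if i < sz a then a else labelAt sz d l (i - sz a) := by
  simp only [labelAt, List.map_cons, blockIndex]
  split_ifs <;> simp

lemma labelAt_append (l l' : List Λ) (i : ℕ) : labelAt sz d (l ++ l') i =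
    if i < (l.map sz).sum then labelAt sz d l i else labelAt sz d l' (i - (l.map sz).sum) := by
  induction l generalizing i with
  | nil => simp
  | cons a l ih =>
    simp only [List.cons_append, labelAt_cons, ih, List.map_cons, List.sum_cons, Nat.sub_sub]
    split_ifs <;> first | rfl | omega

lemma labelAt_eq_getElem {l : List Λ} {i : ℕ} (h : i < (l.map sz).sum) :
    ∃ h' : blockIndex (l.map sz) i < l.length, labelAt sz d l i = l[blockIndex (l.map sz) i] := by
  have h' : blockIndex (l.map sz) i < l.length := by simpa using blockIndex_lt h
  exact ⟨h', List.getD_eq_getElem _ _ h'⟩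

lemma labelAt_mem {l : List Λ} {i : ℕ} (h : i < (l.map sz).sum) : labelAt sz d l i ∈ l := by
  obtain ⟨h', h⟩ := labelAt_eq_getElem sz d h
  rw [h]
  exact List.getElem_mem h'

lemma labelAt_eq_iff {l : List Λ} (hl : l.Nodup) {i j : ℕ} (hi : i < (l.map sz).sum)
    (hj : j < (l.map sz).sum) : labelAt sz d l i = labelAt sz d l j ↔
      blockIndex (l.map sz) i = blockIndex (l.map sz) j := by
  obtain ⟨hi', hi⟩ := labelAt_eq_getElem sz d hi
  obtain ⟨hj', hj⟩ := labelAt_eq_getElem sz d hj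
  rw [hi, hj, hl.getElem_inj_iff]

/-- `Nat.count` splits at the end of the first block, which makes the count additive along the list.
-/
lemma count_labelAt [DecidableEq Λ] (l : List Λ) (x : Λ) :
    Nat.count (fun i => labelAt sz d l i = x) (l.map sz).sum = l.count x * sz x := by
  induction l with
  | nil => simp
  | cons a l ih =>
    rw [List.map_cons, List.sum_cons, Nat.count_add]
    have h1 : Nat.count (fun k => labelAt sz d (a :: l) (sz a + k) = x) (l.map sz).sum =
        Nat.count (fun i => labelAt sz d l i = x) (l.map sz).sum := by
      congr 1
      funext k
      simp [labelAt_cons]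
    rw [h1, ih, List.count_cons]
    by_cases h : a = x
    · have : Nat.count (fun i => labelAt sz d (a :: l) i = x) (sz a) = sz a := by
        rw [Nat.count_iff_forall]
        intro k hk
        rw [labelAt_cons, if_pos hk, h]
      rw [this, h]
      simp only [beq_self_eq_true, if_true]
      ring
    · have : Nat.count (fun i => labelAt sz d (a :: l) i = x) (sz a) = 0 := by
        rw [Nat.count_iff_forall_not]
        intro k hk
        rwa [labelAt_cons, if_pos hk]
      simp [this, h]

lemma card_labelAt [DecidableEq Λ] {m : ℕ} {l : List Λ} (hl : l.Nodup) (hm : (l.map sz).sum = m)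
    (x : Λ) : Fintype.card {i : Fin m // labelAt sz d l i = x} = if x ∈ l then sz x else 0 := by
  have h := count_labelAt sz d l x
  rw [hm] at h
  rw [Fintype.card_subtype, Finset.card_filter,
    Fin.sum_univ_eq_sum_range (fun i => if labelAt sz d l i = x then 1 else 0) m,
    ← Finset.card_filter, ← Nat.count_eq_card_filter_range, h, hl.count]
  simp

lemma labelAt_reverse {l : List Λ} {i : ℕ} (h : i < (l.map sz).sum) :
    labelAt sz d l.reverse ((l.map sz).sum - (i + 1)) = labelAt sz d l i := by
  have h1 := blockIndex_reverse h
  rw [List.length_map] at h1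
  have h2 : blockIndex (l.map sz).reverse ((l.map sz).sum - (i + 1)) < l.length := by omega
  obtain ⟨h', h⟩ := labelAt_eq_getElem sz d h
  rw [h, labelAt, List.map_reverse, List.getD_eq_getElem _ _ (by simpa using h2),
    List.getElem_reverse]
  congr 1
  omega

lemma labelAt_map (n : Λ → Λ) (hn : ∀ x, sz (n x) = sz x) {l : List Λ} {i : ℕ}
    (h : i < (l.map sz).sum) : labelAt sz d (l.map n) i = n (labelAt sz d l i) := by
  induction l generalizing i with
  | nil => simp at h
  | cons a l ih =>
    simp only [List.map_cons, labelAt_cons, hn]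
    simp only [List.map_cons, List.sum_cons] at h
    split_ifs
    · rfl
    · exact ih (by omega)

/-- The position of a block in terms of a grouping of the blocks. -/
lemma exists_group_position (L : List (List Λ)) {i : ℕ} (h : i < (L.flatten.map sz).sum) :
    ∃ (e k : ℕ) (he : e < L.length) (hk : k < L[e].length),
      blockIndex (L.map fun q => (q.map sz).sum) i = e ∧
      blockIndex (L.flatten.map sz) i = ((L.take e).map List.length).sum + k ∧
      labelAt sz d L.flatten i = L[e][k] := by
  induction L generalizing i with
  | nil => simp at h
  | cons q L ih =>
    simp only [List.flatten_cons, List.map_append, List.sum_append] at h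
    simp only [List.flatten_cons, List.map_append, List.map_cons, blockIndex, blockIndex_append,
      labelAt_append]
    by_cases hi : i < (q.map sz).sum
    · obtain ⟨hk, hlab⟩ := labelAt_eq_getElem sz d hi
      refine ⟨0, blockIndex (q.map sz) i, by simp, by simpa using hk, by simp [hi], by simp [hi], ?_⟩
      simp [hi, hlab]
    · obtain ⟨e, k, he, hk, h1, h2, h3⟩ := ih (i := i - (q.map sz).sum) (by omega)
      refine ⟨e + 1, k, by simpa using he, by simpa using hk, ?_, ?_, ?_⟩
      · rw [if_neg hi, h1]
      · rw [if_neg hi, h2]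
        simp only [List.take_succ_cons, List.map_cons, List.sum_cons, List.length_map]
        ring
      · rw [if_neg hi, h3]
        simp

/-- If `τ` reverses each group of labels, then it preserves the groups and reverses the order of
the blocks in each of them. -/
lemma blockIndex_of_reversing {L : List (List Λ)} (hL : L.flatten.Nodup) {τ : Λ → Λ}
    (hτ : ∀ q ∈ L, q.map τ = q.reverse) {i i' : ℕ} (hi : i < (L.flatten.map sz).sum)
    (hi' : i' < (L.flatten.map sz).sum)
    (hii' : labelAt sz d L.flatten i' = τ (labelAt sz d L.flatten i)) :
    blockIndex (L.map fun q => (q.map sz).sum) i' = blockIndex (L.map fun q => (q.map sz).sum) i ∧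
      ∀ j j', j < (L.flatten.map sz).sum → j' < (L.flatten.map sz).sum →
        labelAt sz d L.flatten j' = τ (labelAt sz d L.flatten j) →
        blockIndex (L.map fun q => (q.map sz).sum) i = blockIndex (L.map fun q => (q.map sz).sum) j →
        blockIndex (L.flatten.map sz) i < blockIndex (L.flatten.map sz) j →
        blockIndex (L.flatten.map sz) j' < blockIndex (L.flatten.map sz) i' := by
  rw [List.nodup_flatten] at hL
  -- As labels do not repeat, a label determines its group and its place there; reversal of the
  -- group then sends place `k` to `L[e].length - 1 - k`.
  have huniq : ∀ (e k e' k' : ℕ) (he : e < L.length) (hk : k < L[e].length) (he' : e' < L.length)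
      (hk' : k' < L[e'].length), L[e][k] = L[e'][k'] → e = e' ∧ k = k' := by
    intro e k e' k' he hk he' hk' heq
    have hee' : e = e' := by
      have hdisj := List.pairwise_iff_getElem.mp hL.2
      rcases lt_trichotomy e e' with h | h | h
      · exact absurd (heq ▸ List.getElem_mem hk') (hdisj e e' he he' h (List.getElem_mem hk))
      · exact h
      · exact absurd (heq ▸ List.getElem_mem hk) (hdisj e' e he' he h (List.getElem_mem hk'))
    subst hee'
    exact ⟨rfl, (hL.1 _ (List.getElem_mem he)).getElem_inj_iff.mp heq⟩
  have hkey : ∀ i i', i < (L.flatten.map sz).sum → i' < (L.flatten.map sz).sum →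
      labelAt sz d L.flatten i' = τ (labelAt sz d L.flatten i) →
      ∃ (e k : ℕ) (he : e < L.length), k < L[e].length ∧
        blockIndex (L.map fun q => (q.map sz).sum) i = e ∧
        blockIndex (L.map fun q => (q.map sz).sum) i' = e ∧
        blockIndex (L.flatten.map sz) i = ((L.take e).map List.length).sum + k ∧
        blockIndex (L.flatten.map sz) i' =
          ((L.take e).map List.length).sum + (L[e].length - 1 - k) := by
    intro i i' hi hi' hii'
    obtain ⟨e, k, he, hk, h1, h2, h3⟩ := exists_group_position sz d L hi
    obtain ⟨e', k', he', hk', h1', h2', h3'⟩ := exists_group_position sz d L hi'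
    have hrev : τ L[e][k] = L[e][L[e].length - 1 - k] := by
      have h5 : (L[e].map τ)[k]'(by simpa using hk) = L[e].reverse[k]'(by simpa using hk) := by
        congr 1
        exact hτ _ (List.getElem_mem he)
      rw [List.getElem_map, List.getElem_reverse] at h5
      exact h5
    rw [h3, h3', hrev] at hii'
    obtain ⟨rfl, rfl⟩ := huniq _ _ _ _ _ _ _ _ hii'
    exact ⟨e', k, he, hk, h1, h1', h2, h2'⟩
  obtain ⟨e, k, he, hk, h1, h2, h3, h4⟩ := hkey i i' hi hi' hii'
  refine ⟨h2.trans h1.symm, fun j j' hj hj' hjj' hc hb => ?_⟩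
  obtain ⟨e', k', he', hk', h1', h2', h3', h4'⟩ := hkey j j' hj hj' hjj'
  obtain rfl : e = e' := by rw [← h1, hc, h1']
  omega

end labels

/-! ### Relative longest elements in terms of block labels -/

/-- Labels for the blocks of a standard relevant pair: `neg` describes the order reversal, `τ` the
relative longest element, `sz` the block sizes, and `z` labels the middle block. -/
structure BlockLabels (Λ : Type*) where
  /-- the effect of the order reversal -/
  neg : Λ → Λ
  /-- the effect of the relative longest element -/
  τ : Λ → Λ
  /-- the size of a block -/
  sz : Λ → ℕ
  /-- the first members of the exchanged pairs -/
  A : List Λ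
  /-- the fixed blocks -/
  S : List Λ
  /-- the blocks that are exchanged with their opposites -/
  T : List Λ
  /-- the middle block -/
  z : Λ
  neg_neg : ∀ x, neg (neg x) = x
  τ_τ : ∀ x, τ (τ x) = x
  τ_neg : ∀ x, τ (neg x) = neg (τ x)
  neg_z : neg z = z
  τ_z : τ z = z
  τ_S : ∀ x ∈ S, τ x = x
  τ_T : ∀ x ∈ T, τ x = neg x
  sz_neg : ∀ x, sz (neg x) = sz x
  sz_τ : ∀ x, sz (τ x) = sz x

namespace BlockLabels

variable {Λ : Type*} (D : BlockLabels Λ)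

/-- The labels of the blocks before the middle. -/
def half : List Λ := D.A.flatMap (fun x => [x, D.τ x]) ++ D.S ++ D.T

/-- The labels of all blocks. -/
def labels : List Λ := D.half ++ D.z :: (D.half.map D.neg).reverse

/-- The groups of blocks before the middle. -/
def halfGroups : List (List Λ) := D.A.map (fun x => [x, D.τ x]) ++ D.S.map fun x => [x]

/-- The groups of blocks. -/
def groups : List (List Λ) :=
  D.halfGroups ++
    (D.T ++ D.z :: (D.T.map D.neg).reverse) ::
      ((D.halfGroups.map (List.map D.neg)).map List.reverse).reverse

lemma flatten_halfGroups : D.halfGroups.flatten = D.A.flatMap (fun x => [x, D.τ x]) ++ D.S := by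
  rw [halfGroups, List.flatten_append, ← List.flatMap_def, ← List.flatMap_def]
  congr 1
  exact List.flatMap_pure_eq_map id D.S |>.trans (List.map_id _)

/-- The blocks of the larger Levi are unions of consecutive blocks of the smaller one; the middle
group takes in the blocks of `T`, the middle block and the opposites of `T`. -/
lemma flatten_groups : D.groups.flatten = D.labels := by
  rw [groups, labels, List.flatten_append, List.flatten_cons, ← List.reverse_flatten,
    ← List.map_flatten, flatten_halfGroups, half, ← flatten_halfGroups]
  simp

/-- Each group is an exchanged pair, a singleton, the opposite of one of these, or the middle group,
on which `τ` acts as negation. This reversal makes the element through `τ` longest. -/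
lemma map_τ_of_mem_groups {q : List Λ} (hq : q ∈ D.groups) : q.map D.τ = q.reverse := by
  have hhalf : ∀ q ∈ D.halfGroups, q.map D.τ = q.reverse := by
    intro q hq
    simp only [halfGroups, List.mem_append, List.mem_map] at hq
    rcases hq with ⟨x, -, rfl⟩ | ⟨x, hx, rfl⟩
    · simp [D.τ_τ]
    · simp [D.τ_S x hx]
  simp only [groups, List.mem_append, List.mem_cons, List.mem_reverse, List.mem_map] at hq
  rcases hq with hq | rfl | ⟨-, ⟨q, hq, rfl⟩, rfl⟩
  · exact hhalf q hq
  · have h1 : D.T.map D.τ = D.T.map D.neg := List.map_congr_left D.τ_T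
    have h2 : (D.T.map D.neg).map D.τ = D.T := by
      rw [← h1, List.map_map]
      exact (List.map_congr_left fun x _ => D.τ_τ x).trans (List.map_id _)
    simp only [List.map_append, List.map_cons, List.map_reverse, h2, D.τ_z, h1,
      List.reverse_append, List.reverse_cons, List.reverse_reverse, List.append_assoc,
      List.singleton_append]
  · have : (q.map D.neg).map D.τ = (q.map D.τ).map D.neg := by
      simp only [List.map_map]
      exact List.map_congr_left fun x _ => D.τ_neg x
    rw [List.map_reverse, this, hhalf q hq, List.map_reverse, List.reverse_reverse]

lemma reverse_labels : D.labels.reverse = D.labels.map D.neg := by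
  have : (D.half.map D.neg).map D.neg = D.half := by
    rw [List.map_map]
    exact (List.map_congr_left fun x _ => D.neg_neg x).trans (List.map_id _)
  simp [labels, D.neg_z, this, -List.map_map]

lemma map_sz_neg (l : List Λ) : (l.map D.neg).map D.sz = l.map D.sz := by
  rw [List.map_map]
  exact List.map_congr_left fun x _ => D.sz_neg x

lemma map_sz_half : D.half.map D.sz =
    (D.A.map D.sz).flatMap (fun a => [a, a]) ++ D.S.map D.sz ++ D.T.map D.sz := by
  simp [half, List.map_flatMap, List.flatMap_map, D.sz_τ]

lemma map_sz_labels : D.labels.map D.sz =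
    D.half.map D.sz ++ D.sz D.z :: (D.half.map D.sz).reverse := by
  rw [labels, List.map_append, List.map_cons, List.map_reverse, map_sz_neg]

lemma sum_half : (D.half.map D.sz).sum =
    2 * (D.A.map D.sz).sum + (D.S.map D.sz).sum + (D.T.map D.sz).sum := by
  rw [map_sz_half, List.sum_append, List.sum_append]
  congr 2
  induction D.A.map D.sz with
  | nil => rfl
  | cons a l ih =>
    simp only [List.flatMap_cons, List.sum_append, ih, List.sum_cons, List.sum_nil]
    ring

lemma sum_labels : (D.labels.map D.sz).sum = 2 * (D.half.map D.sz).sum + D.sz D.z := by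
  rw [map_sz_labels, List.sum_append, List.sum_cons, List.sum_reverse]
  ring

lemma map_groups : D.groups.map (fun q => (q.map D.sz).sum) =
    ((D.A.map D.sz).map (fun a => 2 * a) ++ D.S.map D.sz) ++
      (2 * (D.T.map D.sz).sum + D.sz D.z) ::
        ((D.A.map D.sz).map (fun a => 2 * a) ++ D.S.map D.sz).reverse := by
  have h1 : D.halfGroups.map (fun q => (q.map D.sz).sum) =
      (D.A.map D.sz).map (fun a => 2 * a) ++ D.S.map D.sz := by
    simp only [halfGroups, List.map_append, List.map_map]
    congr 1
    refine List.map_congr_left fun x _ => ?_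
    simp [D.sz_τ, two_mul]
  have h2 : ((D.halfGroups.map (List.map D.neg)).map List.reverse).map
      (fun q => (q.map D.sz).sum) = D.halfGroups.map (fun q => (q.map D.sz).sum) := by
    rw [List.map_map, List.map_map]
    refine List.map_congr_left fun q _ => ?_
    simp only [Function.comp_apply, List.map_reverse, map_sz_neg, List.sum_reverse]
  rw [groups, List.map_append, List.map_cons, List.map_reverse, h2, h1]
  congr 2
  simp only [List.map_append, List.map_cons, List.map_reverse, map_sz_neg, List.sum_append,
    List.sum_cons, List.sum_reverse]
  ring

lemma τ_mem_labels {x : Λ} (hx : x ∈ D.labels) : D.τ x ∈ D.labels := by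
  rw [← flatten_groups, List.mem_flatten] at hx ⊢
  obtain ⟨q, hq, hx⟩ := hx
  refine ⟨q, hq, ?_⟩
  rw [← List.mem_reverse, ← D.map_τ_of_mem_groups hq]
  exact List.mem_map_of_mem hx

variable {N : ℕ}

/-- The block function of the smaller Levi subgroup. -/
def block (i : Fin (2 * N)) : ℕ := blockIndex (D.labels.map D.sz) i

/-- The block function of the larger Levi subgroup. -/
def group (i : Fin (2 * N)) : ℕ := blockIndex (D.groups.map fun q => (q.map D.sz).sum) i

/-- The label of the block of a position. -/
def label (i : Fin (2 * N)) : Λ := labelAt D.sz D.z D.labels i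

lemma symmBlocks_block (hN : (D.labels.map D.sz).sum = 2 * N) :
    SymmBlocks (D.block : Fin (2 * N) → ℕ) :=
  symmBlocks_blockIndex (by simp [map_sz_labels]) hN

lemma monotone_group : Monotone (D.group : Fin (2 * N) → ℕ) := fun _ _ h => blockIndex_mono _ h

lemma label_eq_iff (hN : (D.labels.map D.sz).sum = 2 * N) (hD : D.labels.Nodup)
    (i j : Fin (2 * N)) : D.label i = D.label j ↔ D.block i = D.block j :=
  labelAt_eq_iff D.sz D.z hD (by omega) (by omega)

lemma label_mem (hN : (D.labels.map D.sz).sum = 2 * N) (i : Fin (2 * N)) :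
    D.label i ∈ D.labels :=
  labelAt_mem D.sz D.z (by omega)

lemma label_rev (hN : (D.labels.map D.sz).sum = 2 * N) (i : Fin (2 * N)) :
    D.label i.rev = D.neg (D.label i) := by
  have h1 := labelAt_reverse D.sz D.z (l := D.labels) (i := i) (by omega)
  have h2 := labelAt_map D.sz D.z D.neg D.sz_neg (l := D.labels) (i := 2 * N - (i + 1)) (by omega)
  rw [hN, reverse_labels, h2] at h1
  rw [label, label, Fin.val_rev, ← h1, D.neg_neg]

lemma card_label [DecidableEq Λ] (hN : (D.labels.map D.sz).sum = 2 * N) (hD : D.labels.Nodup)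
    (x : Λ) : Fintype.card {i : Fin (2 * N) // D.label i = x} =
      if x ∈ D.labels then D.sz x else 0 :=
  card_labelAt D.sz D.z hD hN x

variable {F : Type*} [Field F]

/-- The smaller Levi subgroup in terms of block sizes. -/
lemma levi_eq_block {u : ℕ} (hu : D.sz D.z = 2 * u) :
    levi F N ((D.A.map D.sz).flatMap (fun a => [a, a]) ++ D.S.map D.sz ++ D.T.map D.sz) u =
      blockDiagonal F N D.block := by
  rw [levi, ← map_sz_half, ← hu, ← map_sz_labels]
  rfl

/-- The larger Levi subgroup in terms of block sizes. -/
lemma levi_eq_group {u : ℕ} (hu : D.sz D.z = 2 * u) :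
    levi F N ((D.A.map D.sz).map (fun a => 2 * a) ++ D.S.map D.sz) (u + (D.T.map D.sz).sum) =
      blockDiagonal F N D.group := by
  have : 2 * (u + (D.T.map D.sz).sum) = 2 * (D.T.map D.sz).sum + D.sz D.z := by
    rw [hu]
    ring
  rw [levi, this, ← map_groups]
  rfl

variable [CharZero F]

/-- The element acting through `τ` on the blocks is the relative longest element. -/
lemma isLongestRelative (hN : (D.labels.map D.sz).sum = 2 * N) (hD : D.labels.Nodup)
    (hlevi : IsStandardLevi (blockDiagonal F N D.block)) (w₀ : Weyl F N)
    (hw₀ : ∀ i, D.label (weylPerm w₀ i) = D.τ (D.label i))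
    (hinc : ∀ i j, i < j → D.block i = D.block j → weylPerm w₀ i < weylPerm w₀ j) (w : Weyl F N) :
    IsLongestRelative (blockDiagonal F N D.block) (blockDiagonal F N D.group) w ↔ w = w₀ := by
  have hb : SymmBlocks (D.block : Fin (2 * N) → ℕ) := D.symmBlocks_block hN
  have hlt : ∀ i : Fin (2 * N), (i : ℕ) < (D.groups.flatten.map D.sz).sum := fun i => by
    rw [flatten_groups]
    omega
  have hrev : ∀ i : Fin (2 * N), _ := fun i =>
    blockIndex_of_reversing D.sz D.z (L := D.groups) (by rwa [flatten_groups])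
      (fun q => D.map_τ_of_mem_groups) (hlt i) (hlt (weylPerm w₀ i))
      (by rw [flatten_groups]; exact hw₀ i)
  rw [flatten_groups] at hrev
  have hgroup : ∀ i, D.group (weylPerm w₀ i) = D.group i := fun i => (hrev i).1
  refine isLongestRelative_iff hb D.monotone_group ⟨_, hlevi, ?_⟩ ?_ ?_ w
  · rw [mem_weylHom_iff hb hb]
    refine ⟨hinc, fun i j => ?_⟩
    rw [← D.label_eq_iff hN hD, ← D.label_eq_iff hN hD, hw₀, hw₀]
    exact ⟨fun h => by rw [h], fun h => by rw [← D.τ_τ (D.label i), h, D.τ_τ]⟩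
  · exact (mem_weylOf_iff _ _).mpr hgroup
  · intro i j hij hc hne
    have h1 : D.block i < D.block j := (hb.mono hij.le).lt_of_ne hne
    have h2 : D.block (weylPerm w₀ j) < D.block (weylPerm w₀ i) :=
      (hrev i).2 j (weylPerm w₀ j) (by omega) (by omega) (hw₀ j) hc h1
    by_contra hcon
    exact absurd (hb.mono (not_lt.mp hcon)) (not_le.mpr h2)

/-- There is a Weyl group element acting through `τ` on the blocks. -/
lemma exists_weylPerm (F : Type*) [Field F] [CharZero F] (hN : (D.labels.map D.sz).sum = 2 * N)
    (hD : D.labels.Nodup) : ∃ w₀ : Weyl F N, (∀ i, D.label (weylPerm w₀ i) = D.τ (D.label i)) ∧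
      ∀ i j, i < j → D.block i = D.block j → weylPerm w₀ i < weylPerm w₀ j := by
  classical
  obtain ⟨π, hπ, hlab, hinc⟩ := exists_symm_perm_increasing_on_fibres
    (D.label : Fin (2 * N) → Λ) (fun i => D.τ (D.label i)) D.neg D.neg_neg (D.label_rev hN)
    (fun i => by rw [D.label_rev hN, D.τ_neg]) fun x => by
      have h1 : ∀ i : Fin (2 * N), D.τ (D.label i) = x ↔ D.label i = D.τ x := fun i =>
        ⟨fun h => by rw [← h, D.τ_τ], fun h => by rw [h, D.τ_τ]⟩
      rw [Fintype.card_congr (Equiv.subtypeEquivRight h1), D.card_label hN hD, D.card_label hN hD,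
        D.sz_τ]
      have h2 : D.τ x ∈ D.labels ↔ x ∈ D.labels :=
        ⟨fun h => by simpa [D.τ_τ] using D.τ_mem_labels h, D.τ_mem_labels⟩
      simp only [h2]
  obtain ⟨w₀, rfl⟩ := exists_weylPerm_eq F π hπ
  refine ⟨w₀, fun i => by rw [← hlab i, D.τ_τ], fun i j hij hb => hinc i j hij ?_⟩
  exact (D.label_eq_iff hN hD i j).mpr hb

/-- The element acting through `τ` is an involution. -/
lemma involutive (hN : (D.labels.map D.sz).sum = 2 * N) (hD : D.labels.Nodup) {w₀ : Weyl F N}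
    (hw₀ : ∀ i, D.label (weylPerm w₀ i) = D.τ (D.label i))
    (hinc : ∀ i j, i < j → D.block i = D.block j → weylPerm w₀ i < weylPerm w₀ j) (i : Fin (2 * N)) :
    weylPerm w₀ (weylPerm w₀ i) = i := by
  have := eq_one_of_increasing_on_fibres D.label (weylPerm w₀ * weylPerm w₀)
    (fun i => by rw [Perm.mul_apply, hw₀, hw₀, D.τ_τ]) fun i j hij hf => by
      refine hinc _ _ (hinc _ _ hij ((D.label_eq_iff hN hD i j).mp hf)) ?_
      rw [← D.label_eq_iff hN hD, hw₀, hw₀, hf]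
  exact congrArg (fun π => π i) this

/-- The element acting through `τ` maps no position to its opposite if all blocks that are
exchanged with their opposites have even size. -/
lemma ne_rev_of_even (hN : (D.labels.map D.sz).sum = 2 * N) (hD : D.labels.Nodup) {w₀ : Weyl F N}
    (hw₀ : ∀ i, D.label (weylPerm w₀ i) = D.τ (D.label i))
    (hinc : ∀ i j, i < j → D.block i = D.block j → weylPerm w₀ i < weylPerm w₀ j)
    (heven : ∀ x ∈ D.labels, D.τ x = D.neg x → Even (D.sz x)) (i : Fin (2 * N)) :
    weylPerm w₀ i ≠ i.rev := by
  classical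
  intro hi
  have hx : D.τ (D.label i) = D.neg (D.label i) := by
    rw [← hw₀, hi, D.label_rev hN]
  have hodd : Odd (Fintype.card {j : Fin (2 * N) // D.label j = D.label i}) := by
    refine odd_card_fibre_of_fixed D.label (fun j => (weylPerm w₀ j).rev) i (fun j => ?_)
      (fun j hj => ?_) (fun j k hj hk hjk => ?_) ?_
    · rw [weylPerm_rev, Fin.rev_rev, D.involutive hN hD hw₀ hinc]
    · rw [D.label_rev hN, hw₀, hj, hx, D.neg_neg]
    · exact Fin.rev_lt_rev.mpr (hinc _ _ hjk ((D.label_eq_iff hN hD _ _).mp (hj.trans hk.symm)))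
    · rw [hi, Fin.rev_rev]
  rw [D.card_label hN hD, if_pos (D.label_mem hN i)] at hodd
  exact Nat.not_even_iff_odd.mpr hodd (heven _ (D.label_mem hN i) hx)

lemma nodup_labels (h : D.half.Nodup) (hz : D.z ∉ D.half) (hneg : ∀ x ∈ D.half, D.neg x ∉ D.half) :
    D.labels.Nodup := by
  have hinj : Function.Injective D.neg := fun x y hxy => by rw [← D.neg_neg x, hxy, D.neg_neg]
  rw [labels, List.nodup_append, List.nodup_cons, List.nodup_reverse]
  refine ⟨h, ⟨?_, h.map hinj⟩, ?_⟩
  · rw [List.mem_reverse, List.mem_map]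
    rintro ⟨x, hx, hxz⟩
    rw [← D.neg_z] at hxz
    exact hz (hinj hxz ▸ hx)
  · rintro x hx y hy rfl
    rw [List.mem_cons, List.mem_reverse, List.mem_map] at hy
    rcases hy with rfl | ⟨y, hy, rfl⟩
    · exact hz hx
    · exact hneg y hy hx

end BlockLabels

/-! ### Block isomorphisms -/

/-- A permutation mapping the blocks of `b` to those of `b'`, increasing on each block. -/
structure BlockIso {m : ℕ} (b b' : Fin m → ℕ) (π : Perm (Fin m)) : Prop where
  increasing : ∀ i j, i < j → b i = b j → π i < π j
  block_iff : ∀ i j, b i = b j ↔ b' (π i) = b' (π j)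

namespace BlockIso

variable {m : ℕ} {b b' b'' : Fin m → ℕ} {π ρ : Perm (Fin m)}

lemma mul (hρ : BlockIso b' b'' ρ) (hπ : BlockIso b b' π) : BlockIso b b'' (ρ * π) :=
  ⟨fun i j hij hb => hρ.increasing _ _ (hπ.increasing i j hij hb) ((hπ.block_iff i j).mp hb),
    fun i j => (hπ.block_iff i j).trans (hρ.block_iff _ _)⟩

lemma inv (hπ : BlockIso b b' π) : BlockIso b' b π⁻¹ := by
  have hblock : ∀ i j, b' i = b' j ↔ b (π⁻¹ i) = b (π⁻¹ j) := fun i j => by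
    rw [hπ.block_iff]
    simp
  refine ⟨fun i j hij hb => ?_, hblock⟩
  rcases lt_trichotomy (π⁻¹ i) (π⁻¹ j) with h | h | h
  · exact h
  · exact absurd (π⁻¹.injective h) hij.ne
  · have := hπ.increasing _ _ h ((hblock i j).mp hb).symm
    rw [← Perm.mul_apply, ← Perm.mul_apply, mul_inv_cancel, Perm.one_apply, Perm.one_apply] at this
    exact absurd this hij.asymm

end BlockIso

lemma mem_weylHom_iff_blockIso {F : Type*} [Field F] [CharZero F] {N : ℕ} {b b' : Fin (2 * N) → ℕ}
    (hb : SymmBlocks b) (hb' : SymmBlocks b') (w : Weyl F N) :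
    w ∈ weylHom (blockDiagonal F N b) (blockDiagonal F N b') ↔ BlockIso b b' (weylPerm w) := by
  rw [mem_weylHom_iff hb hb']
  exact ⟨fun h => ⟨h.1, h.2⟩, fun h => ⟨h.1, h.2⟩⟩

/-! ### From standard relevant pairs to admissible elements -/

/-- The labels attached to the block sizes of a standard relevant pair. -/
def listLabels (r s t : List ℕ) (u : ℕ) : BlockLabels (ℤ × ℤ × ℕ) where
  -- The first two coordinates encode the type of a block so that negation and the swap of
  -- coordinates act correctly: `(1, 2)` and `(2, 1)` are exchanged, `(1, 1)` is fixed, `(1, -1)`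
  -- goes to its negative, and `(0, 0)` is the middle. The third coordinate is the place in the
  -- list.
  neg x := (-x.1, -x.2.1, x.2.2)
  τ x := (x.2.1, x.1, x.2.2)
  sz x := if x.1.natAbs ≠ x.2.1.natAbs then r.getD x.2.2 0 else if x.1 = 0 then 2 * u else
    if x.1 = x.2.1 then s.getD x.2.2 0 else t.getD x.2.2 0
  A := (List.range r.length).map fun i => (1, 2, i)
  S := (List.range s.length).map fun i => (1, 1, i)
  T := (List.range t.length).map fun i => (1, -1, i)
  z := (0, 0, 0)
  neg_neg x := by simp
  τ_τ x := rfl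
  τ_neg x := rfl
  neg_z := rfl
  τ_z := rfl
  τ_S x hx := by
    obtain ⟨i, -, rfl⟩ := List.mem_map.mp hx
    rfl
  τ_T x hx := by
    obtain ⟨i, -, rfl⟩ := List.mem_map.mp hx
    rfl
  sz_neg x := by simp
  sz_τ x := by
    obtain ⟨p, q, i⟩ := x
    dsimp only
    split_ifs <;> first | rfl | omega

namespace listLabels

variable (r s t : List ℕ) (u : ℕ)

lemma map_range_getD (l : List ℕ) : (List.range l.length).map (fun i => l.getD i 0) = l := by
  refine List.ext_getElem (by simp) fun i h h' => ?_
  simp [h']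

lemma map_A : (listLabels r s t u).A.map (listLabels r s t u).sz = r := by
  conv_rhs => rw [← map_range_getD r]
  simp [listLabels]

lemma map_S : (listLabels r s t u).S.map (listLabels r s t u).sz = s := by
  conv_rhs => rw [← map_range_getD s]
  simp [listLabels]

lemma map_T : (listLabels r s t u).T.map (listLabels r s t u).sz = t := by
  conv_rhs => rw [← map_range_getD t]
  simp [listLabels]

/-- The types in the first half are distinct from one another, from their negatives and from zero;
within a type the index separates the labels. -/
lemma nodup : (listLabels r s t u).labels.Nodup := by
  have hmem : ∀ x ∈ (listLabels r s t u).half,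
      (x.1 = 1 ∧ x.2.1 = 2) ∨ (x.1 = 2 ∧ x.2.1 = 1) ∨ (x.1 = 1 ∧ x.2.1 = 1) ∨
        (x.1 = 1 ∧ x.2.1 = -1) := by
    intro x hx
    simp only [BlockLabels.half, listLabels, List.mem_append, List.mem_flatMap, List.mem_map,
      List.mem_cons, List.not_mem_nil, or_false] at hx
    rcases hx with (⟨-, ⟨i, -, rfl⟩, rfl | rfl⟩ | ⟨i, -, rfl⟩) | ⟨i, -, rfl⟩ <;> simp
  refine BlockLabels.nodup_labels _ ?_ (fun h => ?_) fun x hx hx' => ?_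
  · simp only [BlockLabels.half, listLabels, List.nodup_append, List.nodup_flatMap,
      List.flatMap_map]
    refine ⟨⟨⟨fun i _ => by simp, ?_⟩, ?_, ?_⟩, ?_, ?_⟩
    · refine List.nodup_range.imp fun hij => ?_
      simpa [Function.onFun] using Ne.symm hij
    · exact List.nodup_range.map fun i j h => by simpa using h
    · rintro x hx y hy rfl
      simp only [List.mem_flatMap, List.mem_map, List.mem_cons, List.not_mem_nil, or_false] at hx hy
      obtain ⟨j, -, rfl⟩ := hy
      obtain ⟨i, -, hx | hx⟩ := hx <;> simp at hx
    · exact List.nodup_range.map fun i j h => by simpa using h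
    · rintro x hx y hy rfl
      simp only [List.mem_append, List.mem_flatMap, List.mem_map, List.mem_cons, List.not_mem_nil,
        or_false] at hx hy
      obtain ⟨j, -, rfl⟩ := hy
      obtain ⟨i, -, hx | hx⟩ | ⟨i, -, hx⟩ := hx <;> simp at hx
  · have := hmem _ h
    simp [listLabels] at this
  · have h1 := hmem x hx
    have h2 := hmem _ hx'
    simp only [listLabels] at h2
    omega

/-- The condition forces the first two coordinates to be opposite, so the size is that of the middle
block or an entry of `t`; the default value `0` is even as well. -/
lemma even_sz (ht : ∀ a ∈ t, Even a) (x : ℤ × ℤ × ℕ)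
    (hx : (listLabels r s t u).τ x = (listLabels r s t u).neg x) :
    Even ((listLabels r s t u).sz x) := by
  obtain ⟨p, q, i⟩ := x
  simp only [listLabels, Prod.mk.injEq] at hx
  have h1 : p.natAbs = q.natAbs := by omega
  simp only [listLabels, h1, ne_eq, not_true_eq_false, if_false]
  split_ifs with h2 h3
  · exact even_two_mul u
  · omega
  · rw [List.getD_eq_getElem?_getD]
    rcases h : t[i]? with _ | a
    · simp
    · exact ht a (List.mem_of_getElem? h)

end listLabels

/-- Conjugates of the relative longest elements of standard relevant pairs are admissible. -/
lemma mem_weylAdmissible_of_relevant {F : Type*} [Field F] [CharZero F] {n : ℕ}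
    {b : Fin (2 * (2 * n)) → ℕ} (hb : SymmBlocks b) {M' L' : Subgroup (Sp F (2 * n))}
    {w₀ σ : Weyl F (2 * n)} (hrel : IsStandardRelevant M' L') (hw₀ : IsLongestRelative M' L' w₀)
    (hσ : σ ∈ weylHom M' (blockDiagonal F (2 * n) b)) :
    σ * w₀ * σ⁻¹ ∈ weylAdmissible (blockDiagonal F (2 * n) b) := by
  obtain ⟨r, s, t, u, v, hr, hs, ht, hte, rfl, hsum, rfl, rfl⟩ := hrel
  let D := listLabels r s t u
  have hA : D.A.map D.sz = r := listLabels.map_A r s t u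
  have hS : D.S.map D.sz = s := listLabels.map_S r s t u
  have hT : D.T.map D.sz = t := listLabels.map_T r s t u
  have hz : D.sz D.z = 2 * u := rfl
  have hD : D.labels.Nodup := listLabels.nodup r s t u
  have hN : (D.labels.map D.sz).sum = 2 * (2 * n) := by
    rw [D.sum_labels, D.sum_half, hA, hS, hT, hz, ← hsum]
    ring
  have hblock := D.levi_eq_block (F := F) (N := 2 * n) hz
  have hgroup := D.levi_eq_group (F := F) (N := 2 * n) hz
  rw [hA, hS, hT] at hblock hgroup
  have hlevi : IsStandardLevi (blockDiagonal F (2 * n) D.block) := by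
    refine ⟨_, u, ?_, ?_, hblock.symm⟩
    · intro a ha
      simp only [List.mem_append, List.mem_flatMap, List.mem_cons, List.not_mem_nil, or_false,
        or_self] at ha
      rcases ha with (⟨c, hc, rfl⟩ | ha) | ha
      · exact hr _ hc
      · exact hs _ ha
      · exact ht _ ha
    · have := D.sum_half
      rw [D.map_sz_half, hA, hS, hT] at this
      rw [this, ← hsum]
      ring
  obtain ⟨w₁, hw₁, hinc⟩ := D.exists_weylPerm F hN hD
  rw [hblock, hgroup, D.isLongestRelative hN hD hlevi w₁ hw₁ hinc] at hw₀
  subst hw₀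
  have hbD : SymmBlocks D.block := D.symmBlocks_block hN
  rw [hblock, mem_weylHom_iff_blockIso hbD hb] at hσ
  have hiso : BlockIso D.block D.block (weylPerm w₀) := by
    refine ⟨hinc, fun i j => ?_⟩
    rw [← D.label_eq_iff hN hD, ← D.label_eq_iff hN hD, hw₁, hw₁]
    exact ⟨fun h => by rw [h], fun h => by rw [← D.τ_τ (D.label i), h, D.τ_τ]⟩
  have hinvol := D.involutive hN hD hw₁ hinc
  have hne := D.ne_rev_of_even hN hD hw₁ hinc fun x _ => listLabels.even_sz r s t u hte x
  have hσinv : ∀ i, weylPerm σ⁻¹ (weylPerm σ i) = i := fun i => by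
    rw [← Perm.mul_apply, ← map_mul, inv_mul_cancel, map_one, Perm.one_apply]
  rw [mem_weylAdmissible_iff hb, mem_weylHom_iff_blockIso hb hb]
  refine ⟨?_, fun i => ?_, fun i hi => ?_⟩
  · rw [map_mul, map_mul, map_inv]
    exact (hσ.mul hiso).mul hσ.inv
  · obtain ⟨i, rfl⟩ := (weylPerm σ).surjective i
    simp only [map_mul, Perm.mul_apply, hσinv, hinvol]
  · obtain ⟨i, rfl⟩ := (weylPerm σ).surjective i
    simp only [map_mul, Perm.mul_apply, hσinv, ← weylPerm_rev] at hi
    exact hne i ((weylPerm σ).injective hi)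

/-! ### From admissible elements to standard relevant pairs -/

/-- The action of a permutation on the values of a function, extended by the identity. -/
def blockAction {m : ℕ} (β : Fin m → ℤ) (π : Perm (Fin m)) (x : ℤ) : ℤ :=
  open Classical in if h : ∃ i, β i = x then β (π h.choose) else x

section blockAction

variable {m : ℕ} {β : Fin m → ℤ} {π : Perm (Fin m)}

lemma blockAction_apply (hβ : ∀ i j, β i = β j → β (π i) = β (π j)) (i : Fin m) :
    blockAction β π (β i) = β (π i) := by
  have h : ∃ j, β j = β i := ⟨i, rfl⟩
  rw [blockAction, dif_pos h]
  exact hβ _ _ h.choose_spec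

lemma blockAction_of_not_exists {x : ℤ} (h : ¬ ∃ i, β i = x) : blockAction β π x = x :=
  dif_neg h

lemma blockAction_blockAction (hβ : ∀ i j, β i = β j → β (π i) = β (π j))
    (hsq : ∀ i, π (π i) = i) (x : ℤ) : blockAction β π (blockAction β π x) = x := by
  by_cases h : ∃ i, β i = x
  · obtain ⟨i, rfl⟩ := h
    rw [blockAction_apply hβ, blockAction_apply hβ, hsq]
  · rw [blockAction_of_not_exists h, blockAction_of_not_exists h]

lemma blockAction_neg (hβ : ∀ i j, β i = β j → β (π i) = β (π j)) (hrev : ∀ i, β i.rev = -β i)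
    (hπ : ∀ i, π i.rev = (π i).rev) (x : ℤ) : blockAction β π (-x) = -blockAction β π x := by
  by_cases h : ∃ i, β i = x
  · obtain ⟨i, rfl⟩ := h
    rw [← hrev, blockAction_apply hβ, blockAction_apply hβ, hπ, hrev]
  · have h' : ¬ ∃ i, β i = -x := fun ⟨i, hi⟩ => h ⟨i.rev, by rw [hrev, hi, neg_neg]⟩
    rw [blockAction_of_not_exists h, blockAction_of_not_exists h']

end blockAction

/-- The labels attached to an involution of the blocks. -/
def involutionLabels {m : ℕ} (β : Fin m → ℤ) (π : Perm (Fin m))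
    (hβ : ∀ i j, β i = β j → β (π i) = β (π j)) (hrev : ∀ i, β i.rev = -β i)
    (hπ : ∀ i, π i.rev = (π i).rev) (hsq : ∀ i, π (π i) = i) : BlockLabels ℤ where
  neg x := -x
  τ := blockAction β π
  sz x := Fintype.card {i // β i = x}
  -- These inequalities say that `x` is the strict minimum of `x`, `τ x` and their negatives, which
  -- picks one representative of each orbit of four.
  A := ((Finset.univ.image β).filter fun x =>
    x < 0 ∧ x < blockAction β π x ∧ blockAction β π x < -x).toList
  S := ((Finset.univ.image β).filter fun x => x < 0 ∧ blockAction β π x = x).toList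
  T := ((Finset.univ.image β).filter fun x => x < 0 ∧ blockAction β π x = -x).toList
  z := 0
  neg_neg := neg_neg
  τ_τ := blockAction_blockAction hβ hsq
  τ_neg := blockAction_neg hβ hrev hπ
  neg_z := neg_zero
  τ_z := by
    -- Compatibility with negation makes the image of `0` its own negative.
    have := blockAction_neg hβ hrev hπ 0
    rw [neg_zero] at this
    omega
  τ_S x hx := by
    rw [Finset.mem_toList, Finset.mem_filter] at hx
    exact hx.2.2
  τ_T x hx := by
    rw [Finset.mem_toList, Finset.mem_filter] at hx
    exact hx.2.2
  sz_neg x := Fintype.card_congr (Fin.revPerm.subtypeEquiv fun i => by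
    rw [Fin.revPerm_apply, hrev]
    omega)
  sz_τ x := Fintype.card_congr (π.subtypeEquiv fun i => by
    rw [← blockAction_apply hβ]
    constructor
    · intro h
      rw [h, blockAction_blockAction hβ hsq]
    · intro h
      rw [← h, blockAction_blockAction hβ hsq])

namespace involutionLabels

variable {m : ℕ} (β : Fin m → ℤ) (π : Perm (Fin m))
    (hβ : ∀ i j, β i = β j → β (π i) = β (π j)) (hrev : ∀ i, β i.rev = -β i)
    (hπ : ∀ i, π i.rev = (π i).rev) (hsq : ∀ i, π (π i) = i)

/-- Either `x` is negative and a least element among `±x` and `±τ x`, or `τ x` is strictly below the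
other three. In this form disjointness and exhaustion become linear arithmetic. -/
lemma mem_half_iff (x : ℤ) : x ∈ (involutionLabels β π hβ hrev hπ hsq).half ↔
    (∃ i, β i = x) ∧
    ((x < 0 ∧ x ≤ blockAction β π x ∧ blockAction β π x ≤ -x) ∨
      (blockAction β π x < 0 ∧ blockAction β π x < x ∧ x < -blockAction β π x)) := by
  have hττ := blockAction_blockAction hβ hsq
  have hmem : (∃ i, β i = blockAction β π x) ↔ ∃ i, β i = x := by
    constructor
    · rintro ⟨i, hi⟩
      exact ⟨π i, by rw [← blockAction_apply hβ, hi, hττ]⟩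
    · rintro ⟨i, rfl⟩
      exact ⟨π i, (blockAction_apply hβ i).symm⟩
  have hA : x ∈ (involutionLabels β π hβ hrev hπ hsq).A.flatMap
        (fun x => [x, blockAction β π x]) ↔ (∃ i, β i = x) ∧
      ((x < 0 ∧ x < blockAction β π x ∧ blockAction β π x < -x) ∨
      (blockAction β π x < 0 ∧ blockAction β π x < x ∧ x < -blockAction β π x)) := by
    simp only [involutionLabels, List.mem_flatMap, Finset.mem_toList, Finset.mem_filter,
      Finset.mem_image, Finset.mem_univ, true_and, List.mem_cons, List.not_mem_nil, or_false]
    constructor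
    · rintro ⟨y, ⟨hy, h⟩, rfl | rfl⟩
      · exact ⟨hy, Or.inl h⟩
      · rw [hττ] at hmem ⊢
        exact ⟨hmem.mp hy, Or.inr h⟩
    · rintro ⟨hx, h | h⟩
      · exact ⟨x, ⟨hx, h⟩, Or.inl rfl⟩
      · exact ⟨blockAction β π x, ⟨hmem.mpr hx, by rwa [hττ]⟩, Or.inr (hττ x).symm⟩
  rw [BlockLabels.half, List.mem_append, List.mem_append]
  refine (or_congr_left (or_congr_left hA)).trans ?_
  simp only [involutionLabels, Finset.mem_toList, Finset.mem_filter, Finset.mem_image,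
    Finset.mem_univ, true_and]
  rw [← and_or_left, ← and_or_left]
  refine and_congr_right fun _ => ?_
  omega

lemma nodup : (involutionLabels β π hβ hrev hπ hsq).labels.Nodup := by
  have hττ := blockAction_blockAction hβ hsq
  have hneg := blockAction_neg hβ hrev hπ
  refine BlockLabels.nodup_labels _ ?_ ?_ ?_
  · simp only [BlockLabels.half, involutionLabels, List.nodup_append, List.nodup_flatMap,
      Finset.mem_toList, Finset.mem_filter, List.mem_append, List.mem_flatMap, List.mem_cons,
      List.not_mem_nil, or_false, Finset.nodup_toList, true_and]
    refine ⟨⟨⟨?_, ?_⟩, ?_⟩, ?_⟩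
    · rintro x ⟨-, h⟩
      simpa using h.2.1.ne
    · refine (Finset.nodup_toList _).pairwise_of_forall_ne fun x hx y hy hxy => ?_
      simp only [Finset.mem_toList, Finset.mem_filter] at hx hy
      have h1 : x ≠ blockAction β π y := fun h => by
        rw [h, hττ] at hx
        omega
      have h2 : blockAction β π x ≠ y := fun h => by
        rw [← h, hττ] at hy
        omega
      have h3 : blockAction β π x ≠ blockAction β π y := fun h => hxy (by rw [← hττ x, h, hττ])
      simp [Function.onFun, hxy.symm, h1.symm, h2.symm, h3.symm]
    · rintro x ⟨y, ⟨-, hy⟩, rfl | rfl⟩ z ⟨-, hz⟩ rfl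
      · omega
      · rw [hττ] at hz
        omega
    · rintro x (⟨y, ⟨-, hy⟩, rfl | rfl⟩ | ⟨-, hy⟩) z ⟨-, hz⟩ rfl
      · omega
      · rw [hττ] at hz
        omega
      · omega
  · intro h
    have h0 : blockAction β π 0 = 0 := (involutionLabels β π hβ hrev hπ hsq).τ_z
    have h1 : (0 : ℤ) ∈ (involutionLabels β π hβ hrev hπ hsq).half := h
    rw [mem_half_iff] at h1
    omega
  · intro x hx hx'
    have h1 : -x ∈ (involutionLabels β π hβ hrev hπ hsq).half := hx'
    rw [mem_half_iff] at hx h1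
    have := hneg x
    omega

/-- For a negative value `x`, either `x` or `-x` lies in the first half, according to whether `τ x ≤
-x`; negation then handles positive values. -/
lemma mem_labels (i : Fin m) : β i ∈ (involutionLabels β π hβ hrev hπ hsq).labels := by
  have hττ := blockAction_blockAction hβ hsq
  have hneg := blockAction_neg hβ hrev hπ
  set D := involutionLabels β π hβ hrev hπ hsq
  have hnegmem : ∀ x ∈ D.labels, -x ∈ D.labels := fun x hx => by
    rw [← List.mem_reverse, D.reverse_labels]
    exact List.mem_map_of_mem hx
  have hhalf : ∀ x ∈ D.half, x ∈ D.labels := fun x hx => List.mem_append_left _ hx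
  have hlow : ∀ i, β i < 0 → β i ∈ D.labels := by
    intro i hi
    by_cases h : blockAction β π (β i) ≤ -β i
    · refine hhalf _ ((mem_half_iff β π hβ hrev hπ hsq _).mpr ⟨⟨i, rfl⟩, ?_⟩)
      omega
    · rw [← neg_neg (β i)]
      refine hnegmem _ (hhalf _ ((mem_half_iff β π hβ hrev hπ hsq _).mpr
        ⟨⟨i.rev, hrev i⟩, ?_⟩))
      rw [hneg]
      omega
  rcases lt_trichotomy (β i) 0 with h | h | h
  · exact hlow i h
  · rw [h]
    exact List.mem_append_right _ List.mem_cons_self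
  · have h1 := hnegmem _ (hlow i.rev (by rw [hrev]; omega))
    rwa [hrev, neg_neg] at h1

lemma sum_labels :
    ((involutionLabels β π hβ hrev hπ hsq).labels.map
      (involutionLabels β π hβ hrev hπ hsq).sz).sum = m := by
  rw [← List.sum_toFinset _ (nodup β π hβ hrev hπ hsq)]
  have := Finset.card_eq_sum_card_fiberwise (s := Finset.univ) (f := β)
    (t := (involutionLabels β π hβ hrev hπ hsq).labels.toFinset)
    (fun i _ => by simpa using mem_labels β π hβ hrev hπ hsq i)
  rw [Finset.card_univ, Fintype.card_fin] at this
  refine Eq.trans ?_ this.symm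
  exact Finset.sum_congr rfl fun x _ => Fintype.card_subtype (fun i => β i = x)

/-- Reversal after `π` is an involution of this fibre, and a fixed point would give `π i = i.rev`.
-/
lemma even_sz (hne : ∀ i, π i ≠ i.rev) (x : ℤ) (hx : blockAction β π x = -x) :
    Even ((involutionLabels β π hβ hrev hπ hsq).sz x) := by
  change Even (Fintype.card {i // β i = x})
  rw [Fintype.card_subtype]
  refine even_card_of_fixedPointFree _ (fun i => (π i).rev) ?_ ?_ ?_
  · intro i hi
    rw [Finset.mem_filter] at hi ⊢
    refine ⟨Finset.mem_univ _, ?_⟩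
    rw [hrev, ← blockAction_apply hβ, hi.2, hx, neg_neg]
  · intro i _
    rw [hπ, hsq, Fin.rev_rev]
  · intro i _ h
    exact hne i (Fin.rev_eq_iff.mp h)

lemma sz_pos {x : ℤ} (hx : x ∈ (involutionLabels β π hβ hrev hπ hsq).half) :
    0 < (involutionLabels β π hβ hrev hπ hsq).sz x := by
  obtain ⟨i, hi⟩ := ((mem_half_iff β π hβ hrev hπ hsq x).mp hx).1
  change 0 < Fintype.card {i // β i = x}
  exact Fintype.card_pos_iff.mpr ⟨⟨i, hi⟩⟩

end involutionLabels

/-- Every involution of the blocks is described by labels. -/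
lemma exists_blockLabels {m : ℕ} (β : Fin m → ℤ) (π : Perm (Fin m))
    (hβ : ∀ i j, β i = β j → β (π i) = β (π j)) (hrev : ∀ i, β i.rev = -β i)
    (hπ : ∀ i, π i.rev = (π i).rev) (hsq : ∀ i, π (π i) = i) (hne : ∀ i, π i ≠ i.rev) :
    ∃ D : BlockLabels ℤ, D.labels.Nodup ∧ (D.labels.map D.sz).sum = m ∧ (∀ x, D.neg x = -x) ∧
      (∀ i, D.τ (β i) = β (π i)) ∧ (∀ x, Fintype.card {i // β i = x} = D.sz x) ∧
      (∀ i, β i ∈ D.labels) ∧ (∀ x ∈ D.half, 0 < D.sz x) ∧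
      ∀ x, D.τ x = D.neg x → Even (D.sz x) :=
  ⟨involutionLabels β π hβ hrev hπ hsq, involutionLabels.nodup .., involutionLabels.sum_labels ..,
    fun _ => rfl, blockAction_apply hβ, fun _ => rfl, fun i => involutionLabels.mem_labels β π hβ hrev hπ hsq i,
    fun _ hx => involutionLabels.sz_pos β π hβ hrev hπ hsq hx, involutionLabels.even_sz β π hβ hrev hπ hsq hne⟩

/-- Admissible elements are conjugates of relative longest elements of standard relevant pairs. -/
lemma exists_relevant_of_mem_weylAdmissible {F : Type*} [Field F] [CharZero F] {n : ℕ}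
    {b : Fin (2 * (2 * n)) → ℕ} (hb : SymmBlocks b) {L : ℕ} (hL : ∀ i, b i.rev + b i + 1 = L)
    {w : Weyl F (2 * n)} (hw : w ∈ weylAdmissible (blockDiagonal F (2 * n) b)) :
    ∃ (M' L' : Subgroup (Sp F (2 * n))) (w₀ σ : Weyl F (2 * n)),
      IsStandardRelevant M' L' ∧ IsLongestRelative M' L' w₀ ∧
      σ ∈ weylHom M' (blockDiagonal F (2 * n) b) ∧ w = σ * w₀ * σ⁻¹ := by
  rw [mem_weylAdmissible_iff hb, mem_weylHom_iff_blockIso hb hb] at hw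
  obtain ⟨hiso, hsq, hne⟩ := hw
  -- Centring the block index turns the reversal into negation and gives the middle block the value
  -- `0`.
  let β : Fin (2 * (2 * n)) → ℤ := fun i => 2 * b i + 1 - L
  have hβb : ∀ i j, β i = β j ↔ b i = b j := fun i j => by
    simp only [β]
    omega
  have hβ : ∀ i j, β i = β j → β (weylPerm w i) = β (weylPerm w j) := fun i j h => by
    rw [hβb] at h ⊢
    exact (hiso.block_iff i j).mp h
  have hrev : ∀ i, β i.rev = -β i := fun i => by
    have := hL i
    simp only [β]
    omega
  obtain ⟨D, hD, hN, hneg, hτ, hcard, hmem, hpos, heven⟩ :=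
    exists_blockLabels β (weylPerm w) hβ hrev (weylPerm_rev w) hsq hne
  -- `ρ` carries the reordered blocks of `M'` to those of `M`; it becomes `σ`.
  obtain ⟨ρ, hρ, hβρ, hρinc⟩ := exists_symm_perm_increasing_on_fibres D.label β D.neg
    D.neg_neg (D.label_rev hN) (fun i => by rw [hrev, hneg]) fun x => by
      rw [D.card_label hN hD, hcard]
      split_ifs with h
      · rfl
      · rw [← hcard]
        symm
        rw [Fintype.card_eq_zero_iff]
        exact ⟨fun ⟨i, hi⟩ => h (hi ▸ hmem i)⟩
  obtain ⟨σ, rfl⟩ := exists_weylPerm_eq F ρ hρ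
  have hbD : SymmBlocks D.block := D.symmBlocks_block hN
  have hσ : BlockIso D.block b (weylPerm σ) := by
    refine ⟨fun i j hij h => hρinc i j hij ((D.label_eq_iff hN hD i j).mpr h), fun i j => ?_⟩
    rw [← D.label_eq_iff hN hD, ← hβb, hβρ, hβρ]
  have hw₀iso : BlockIso D.block D.block (weylPerm (σ⁻¹ * w * σ)) := by
    rw [map_mul, map_mul, map_inv]
    exact (hσ.inv.mul hiso).mul hσ
  have hw₀ : ∀ i, D.label (weylPerm (σ⁻¹ * w * σ) i) = D.τ (D.label i) := by
    intro i
    have h1 : weylPerm σ (weylPerm (σ⁻¹ * w * σ) i) = weylPerm w (weylPerm σ i) := by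
      rw [map_mul, map_mul, map_inv]
      exact (weylPerm σ).apply_symm_apply _
    rw [← hβρ, h1, ← hτ, hβρ]
  have hposmap : ∀ l : List ℤ, (∀ x ∈ l, x ∈ D.half) → ∀ a ∈ l.map D.sz, 0 < a := by
    intro l hl a ha
    obtain ⟨x, hx, rfl⟩ := List.mem_map.mp ha
    exact hpos x (hl x hx)
  have hApos := hposmap D.A fun x hx => List.mem_append_left _ (List.mem_append_left _
    (List.mem_flatMap.mpr ⟨x, hx, List.mem_cons_self⟩))
  have hSpos := hposmap D.S fun x hx => List.mem_append_left _ (List.mem_append_right _ hx)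
  have hTpos := hposmap D.T fun x hx => List.mem_append_right _ hx
  have hTeven : ∀ a ∈ D.T.map D.sz, Even a := by
    intro a ha
    obtain ⟨x, hx, rfl⟩ := List.mem_map.mp ha
    exact heven x (D.τ_T x hx)
  -- The middle label is fixed by `τ` and by negation, so the parity statement covers it too; its
  -- size may be zero.
  obtain ⟨u, hu⟩ : ∃ u, D.sz D.z = 2 * u :=
    even_iff_exists_two_mul.mp (heven _ (by rw [D.τ_z, D.neg_z]))
  have hblock := D.levi_eq_block (F := F) (N := 2 * n) hu
  have hgroup := D.levi_eq_group (F := F) (N := 2 * n) hu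
  have hsum : 2 * (D.A.map D.sz).sum + (D.S.map D.sz).sum + (u + (D.T.map D.sz).sum) = 2 * n := by
    have := D.sum_labels
    rw [hN, D.sum_half, hu] at this
    omega
  have hlevi : IsStandardLevi (blockDiagonal F (2 * n) D.block) := by
    refine ⟨_, u, ?_, ?_, hblock.symm⟩
    · intro a ha
      simp only [List.mem_append, List.mem_flatMap, List.mem_cons, List.not_mem_nil, or_false,
        or_self] at ha
      rcases ha with (⟨c, hc, rfl⟩ | ha) | ha
      · exact hApos _ hc
      · exact hSpos _ ha
      · exact hTpos _ ha
    · rw [← D.map_sz_half, D.sum_half]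
      omega
  refine ⟨blockDiagonal F (2 * n) D.block, blockDiagonal F (2 * n) D.group, σ⁻¹ * w * σ, σ,
    ⟨D.A.map D.sz, D.S.map D.sz, D.T.map D.sz, u, _, hApos, hSpos, hTpos, hTeven, rfl, hsum,
      hblock.symm, hgroup.symm⟩, ?_, ?_, by group⟩
  · exact (D.isLongestRelative hN hD hlevi _ hw₀ hw₀iso.increasing _).mpr rfl
  · exact (mem_weylHom_iff_blockIso hbD hb σ).mpr hσ

end SymplecticWeyl

end

theorem mainTheorem9 (F : Type*) [Field F] [NumberField F] (n : ℕ)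
    (M : Subgroup (SymplecticWeyl.Sp F (2 * n))) (hM : SymplecticWeyl.IsStandardLevi M) :
    SymplecticWeyl.weylAdmissible M =
      {w | ∃ (M' L' : Subgroup (SymplecticWeyl.Sp F (2 * n)))
          (w₀ σ : SymplecticWeyl.Weyl F (2 * n)),
        SymplecticWeyl.IsStandardRelevant M' L' ∧
        SymplecticWeyl.IsLongestRelative M' L' w₀ ∧
        σ ∈ SymplecticWeyl.weylHom M' M ∧
        w = σ * w₀ * σ⁻¹} := by
  obtain ⟨ns, r, -, hsum, rfl⟩ := hM
  have hb := SymplecticWeyl.symmBlocks_levi hsum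
  have hlsum : (ns ++ (2 * r) :: ns.reverse).sum = 2 * (2 * n) := by
    simp only [List.sum_append, List.sum_cons, List.sum_reverse]
    omega
  ext w
  constructor
  · refine SymplecticWeyl.exists_relevant_of_mem_weylAdmissible hb
      (L := (ns ++ (2 * r) :: ns.reverse).length) fun i => ?_
    have := SymplecticWeyl.blockIndex_reverse (l := ns ++ (2 * r) :: ns.reverse) (i := i) (by omega)
    rw [hlsum] at this
    simpa [Fin.val_rev] using this
  · rintro ⟨M', L', w₀, σ, hrel, hw₀, hσ, rfl⟩
    exact SymplecticWeyl.mem_weylAdmissible_of_relevant hb hrel hw₀ hσ
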